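/- Let $\mathbb{K}$ be an algebraically closed field of characteristic $0$. Let $\mathcal{L}ie_8\subset\mathbb{K}^{8^3}$ be the variety of structure constants of $8$-dimensional Lie algebras (in a fixed basis $X_0,\dots,X_7$ of $\mathbb{K}^8$), $\mathcal{N}il_8\subset\mathcal{L}ie_8$ the subset of nilpotent ones, and $\mathcal{F}il_8\subset\mathcal{N}il_8$ the subset of filiform ones, i.e. those nilpotent Lie algebras whose ascending central series satisfies $\dim\mathcal{C}_i=i$ for $0\le i\le 6$. All carry the Zariski topology; $GL(8,\mathbb{K})$ acts by changes of basis, the orbit $\mathcal{O}(\mu)$ of $\mu$ is its isomorphism class, and $\mathcal{O}(F)$ is the union of the orbits of the elements of a family $F$. Let $Fil_8\subset\mathcal{F}il_8$ be the set of the skew-symmetric brackets (other brackets of basis vectors $X_i,X_j$, $i<j$, being zero) $$\begin{cases}\mu(X_0,X_i)=X_{i+1},\quad 1\le i\le 6,\\ \mu(X_2,X_5)=a_1X_7,\quad \mu(X_1,X_5)=a_1X_6+a_2X_7,\quad \mu(X_3,X_4)=-a_1X_7,\quad \mu(X_2,X_4)=a_4X_7,\\ \mu(X_1,X_4)=a_1X_5+(a_2+a_4)X_6+a_5X_7,\quad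 \mu(X_2,X_3)=a_4X_6+a_6X_7,\\ \mu(X_1,X_3)=a_1X_4+(a_2+2a_4)X_5+(a_5+a_6)X_6+a_7X_7,\\ \mu(X_1,X_2)=a_1X_3+(a_2+2a_4)X_4+(a_5+a_6)X_5+a_7X_6+a_8X_7,\end{cases}$$ with $a_1(5a_4+2a_2)=0$, and let $Fil_8(1)$, $Fil_8(2)$ be its subsets defined by $a_1=0$ and by $5a_4+2a_2=0$; put $\mathcal{F}il_8(i)=\mathcal{O}(Fil_8(i))$. For $V\subseteq\mathcal{L}ie_8$, an algebra $\mu\in V$ is rigid in $V$ if $\mathcal{O}(\mu)\cap V$ is open in $V$, and a family $F\subseteq V$ is rigid in $V$ if $\mathcal{O}(F)\cap V$ is open in $V$. Let $\mathcal{T}^2(8)=\{\mathcal{T}^2_t(8): t\in\mathbb{K}\}$ be the family of the brackets above with $(a_1,a_2,a_4,a_5,a_6,a_7,a_8)=(1,1,-\tfrac25,t,-t,0,0)$, and $\mathcal{T}^1=\{\mathcal{T}^1_\alpha:\alpha\in\mathbb{K},\ \alpha\ne-1\}$ the family of those with $(a_1,a_2,a_4,a_5,a_6,a_7,a_8)=(0,\alpha,1,1,0,0,0)$.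 (2) No Lie algebra in $Fil_8(2)$ is rigid in $Fil_8$, in $\mathcal{F}il_8$, in $\mathcal{N}il_8$ or in $\mathcal{L}ie_8$. The algebras $\mathcal{T}^2_t(8)$ are pairwise non-isomorphic, the family $\mathcal{T}^2(8)$ is rigid in $Fil_8$ and in $\mathcal{F}il_8$, and $Fil_8(2)$ is the closure in $Fil_8$ of $\mathcal{O}(\mathcal{T}^2(8))\cap Fil_8$; likewise $\mathcal{F}il_8(2)$ is the closure of $\mathcal{O}(\mathcal{T}^2(8))$ in $\mathcal{F}il_8$. (1) No Lie algebra in $Fil_8(1)$ is rigid in $Fil_8$, in $\mathcal{F}il_8$, in $\mathcal{N}il_8$ or in $\mathcal{L}ie_8$. The algebras $\mathcal{T}^1_\alpha$, $\alpha\neq-1$, are pairwise non-isomorphic, the family $\mathcal{T}^1$ is rigid in $Fil_8(1)$ and in $\mathcal{F}il_8(1)$, and $Fil_8(1)$ is the closure in $Fil_8$ of $\mathcal{O}(\mathcal{T}^1)\cap Fil_8$; likewise $\mathcal{F}il_8(1)$ is the closure of $\mathcal{O}(\mathcal{T}^1)$ in $\mathcal{F}il_8$. -/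

import Mathlib

/-! Structure constants of brackets on `K⁸` and the Zariski topology on the space of them. -/

/-- The affine space `K^(8³)` of structure constants: `c (i, j, k)` is the coefficient of `X k` in
`μ (X i, X j)`, where `X 0, …, X 7` is the canonical basis of `K⁸`. -/
abbrev StructConst (K : Type*) : Type _ := Fin 8 × Fin 8 × Fin 8 → K

/-- A subset of the affine space is Zariski closed if it is the zero set of polynomials. -/
def IsZariskiClosed {K : Type*} [Field K] (Z : Set (StructConst K)) : Prop :=
  ∃ I : Ideal (MvPolynomial (Fin 8 × Fin 8 × Fin 8) K), Z = MvPolynomial.zeroLocus K I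

/-- `S` is a Zariski open subset of `V` (for the topology induced on `V`). -/
def IsZariskiOpenIn {K : Type*} [Field K] (V S : Set (StructConst K)) : Prop :=
  ∃ Z : Set (StructConst K), IsZariskiClosed Z ∧ S = V \ Z

/-- The Zariski closure of `S` in `V` (for the topology induced on `V`): the points of `V` that lie
in every Zariski closed set containing `S`. -/
def zariskiClosureIn {K : Type*} [Field K] (V S : Set (StructConst K)) : Set (StructConst K) :=
  {c | c ∈ V ∧ ∀ Z : Set (StructConst K), IsZariskiClosed Z → S ⊆ Z → c ∈ Z}

/-- The bilinear map `μ` on `K⁸` with structure constants `c`. -/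
def bracket {K : Type*} [Field K] (c : StructConst K) (x y : Fin 8 → K) : Fin 8 → K :=
  fun k => ∑ i, ∑ j, x i * y j * c (i, j, k)

theorem bracket_add_left {K : Type*} [Field K] (c : StructConst K) (x x' y : Fin 8 → K) :
    bracket c (x + x') y = bracket c x y + bracket c x' y := by
  funext k
  simp only [bracket, Pi.add_apply, add_mul, Finset.sum_add_distrib]

theorem bracket_smul_left {K : Type*} [Field K] (c : StructConst K) (r : K) (x y : Fin 8 → K) :
    bracket c (r • x) y = r • bracket c x y := by
  funext k
  simp only [bracket, Pi.smul_apply, smul_eq_mul, Finset.mul_sum, mul_assoc]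

theorem bracket_zero_left {K : Type*} [Field K] (c : StructConst K) (y : Fin 8 → K) :
    bracket c 0 y = 0 := by
  funext k
  simp [bracket]

/-- The orbit of `c` under the action of `GL(8, K)` by changes of basis, that is the isomorphism
class of `c`: the brackets `(x, y) ↦ g (μ (g⁻¹ x, g⁻¹ y))`. -/
def lawOrbit {K : Type*} [Field K] (c : StructConst K) : Set (StructConst K) :=
  {d | ∃ g : (Fin 8 → K) ≃ₗ[K] (Fin 8 → K),
    ∀ x y : Fin 8 → K, bracket d (g x) (g y) = g (bracket c x y)}

/-- The union of the orbits of the elements of `F`. -/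
def familyOrbit {K : Type*} [Field K] (F : Set (StructConst K)) : Set (StructConst K) :=
  {d | ∃ c ∈ F, d ∈ lawOrbit c}

/-- The variety of 8-dimensional Lie algebras: skew-symmetry and the Jacobi identity. -/
def LieVar (K : Type*) [Field K] : Set (StructConst K) :=
  {c | (∀ i j k, c (i, j, k) = -c (j, i, k)) ∧
    ∀ i j k s, ∑ l, (c (i, j, l) * c (l, k, s) + c (j, k, l) * c (l, i, s)
      + c (k, i, l) * c (l, j, s)) = 0}

/-- The ascending central series: `C₀ = 0` and `C_{i+1} = {x | [x, g] ⊆ C_i}`. -/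
def ascSeries {K : Type*} [Field K] (c : StructConst K) : ℕ → Submodule K (Fin 8 → K)
  | 0 => ⊥
  | i + 1 =>
    { carrier := {x | ∀ y, bracket c x y ∈ ascSeries c i}
      add_mem' := fun {a b} ha hb y => by
        rw [bracket_add_left]
        exact Submodule.add_mem _ (ha y) (hb y)
      zero_mem' := fun y => by
        rw [bracket_zero_left]
        exact Submodule.zero_mem _
      smul_mem' := fun r x hx y => by
        rw [bracket_smul_left]
        exact Submodule.smul_mem _ r (hx y) }

/-- The variety of 8-dimensional nilpotent Lie algebras. -/
def NilVar (K : Type*) [Field K] : Set (StructConst K) :=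
  {c | c ∈ LieVar K ∧ ∃ m : ℕ, ascSeries c m = ⊤}

/-- The set of 8-dimensional filiform Lie algebras: the nilpotent Lie algebras such that
`dim C_i = i` for `0 ≤ i ≤ 6`. -/
def FilVar (K : Type*) [Field K] : Set (StructConst K) :=
  {c | c ∈ NilVar K ∧ ∀ i : ℕ, i ≤ 6 → Module.finrank K (ascSeries c i) = i}

/-! Filiform brackets for which the canonical basis is a Vergne basis. -/

/-- The basis vector `X k` of `K⁸`. -/
def basisVec (K : Type*) [Field K] (k : Fin 8) : Fin 8 → K := Pi.single k 1

/-- The brackets `μ (X i, X j)`, `i < j`, in terms of the parameters. -/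
def vergneUpper {K : Type*} [Field K] (a₁ a₂ a₄ a₅ a₆ a₇ a₈ : K) (i j : Fin 8) : Fin 8 → K :=
  let X := basisVec K
  match i, j with
  | 0, 1 => X 2
  | 0, 2 => X 3
  | 0, 3 => X 4
  | 0, 4 => X 5
  | 0, 5 => X 6
  | 0, 6 => X 7
  | 2, 5 => a₁ • X 7
  | 1, 5 => a₁ • X 6 + a₂ • X 7
  | 3, 4 => -a₁ • X 7
  | 2, 4 => a₄ • X 7
  | 1, 4 => a₁ • X 5 + (a₂ + a₄) • X 6 + a₅ • X 7
  | 2, 3 => a₄ • X 6 + a₆ • X 7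
  | 1, 3 => a₁ • X 4 + (a₂ + 2 * a₄) • X 5 + (a₅ + a₆) • X 6 + a₇ • X 7
  | 1, 2 => a₁ • X 3 + (a₂ + 2 * a₄) • X 4 + (a₅ + a₆) • X 5 + a₇ • X 6 + a₈ • X 7
  | _, _ => 0

/-- The skew-symmetric bracket with the given parameters (`X 1 ↦ X 2 ↦ ⋯ ↦ X 7` under `ad X 0`). -/
def vergneLaw {K : Type*} [Field K] (a₁ a₂ a₄ a₅ a₆ a₇ a₈ : K) : StructConst K :=
  fun p => vergneUpper a₁ a₂ a₄ a₅ a₆ a₇ a₈ p.1 p.2.1 p.2.2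
    - vergneUpper a₁ a₂ a₄ a₅ a₆ a₇ a₈ p.2.1 p.1 p.2.2

/-- The variety of filiform brackets given in a Vergne basis. -/
def VergneFil (K : Type*) [Field K] : Set (StructConst K) :=
  {c | ∃ a₁ a₂ a₄ a₅ a₆ a₇ a₈ : K, a₁ * (5 * a₄ + 2 * a₂) = 0 ∧
    c = vergneLaw a₁ a₂ a₄ a₅ a₆ a₇ a₈}

/-- The first component, `a₁ = 0`. -/
def VergneFilOne (K : Type*) [Field K] : Set (StructConst K) :=
  {c | ∃ a₂ a₄ a₅ a₆ a₇ a₈ : K, c = vergneLaw 0 a₂ a₄ a₅ a₆ a₇ a₈}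

/-- The second component, `5 a₄ + 2 a₂ = 0`. -/
def VergneFilTwo (K : Type*) [Field K] : Set (StructConst K) :=
  {c | ∃ a₁ a₂ a₄ a₅ a₆ a₇ a₈ : K, 5 * a₄ + 2 * a₂ = 0 ∧
    c = vergneLaw a₁ a₂ a₄ a₅ a₆ a₇ a₈}

/-- The law with parameter `α` of the first family. -/
def lawOne {K : Type*} [Field K] (α : K) : StructConst K := vergneLaw 0 α 1 1 0 0 0

/-- The first family, `α ≠ -1`. -/
def familyOne (K : Type*) [Field K] : Set (StructConst K) := {c | ∃ α : K, α ≠ -1 ∧ c = lawOne α}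

/-- The law with parameter `t` of the second family. -/
def lawTwo {K : Type*} [Field K] (t : K) : StructConst K := vergneLaw 1 1 (-2 / 5) t (-t) 0 0

/-- The second family. -/
def familyTwo (K : Type*) [Field K] : Set (StructConst K) := {c | ∃ t : K, c = lawTwo t}

/-- `c` is rigid in `V`: the algebras of `V` isomorphic to `c` form a Zariski open subset of `V`. -/
def IsRigidIn {K : Type*} [Field K] (V : Set (StructConst K)) (c : StructConst K) : Prop :=
  IsZariskiOpenIn V (lawOrbit c ∩ V)

/-- The family `F` of elements of `V` is rigid in `V`: the algebras of `V` isomorphic to a member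
of `F` form a Zariski open subset of `V`. -/
def IsRigidFamilyIn {K : Type*} [Field K] (V F : Set (StructConst K)) : Prop :=
  F ⊆ V ∧ IsZariskiOpenIn V (familyOrbit F ∩ V)

/-! The argument rests on a normal form, genericity, and lines.

Normal form. In a filiform algebra pick `x` with `(ad x)⁶ y ≠ 0` for some `y`, and correct `y` by a
multiple of `x` so that it commutes with `(ad x)⁵ y`. The vectors `x, y, (ad x) y, …, (ad x)⁶ y`
form a basis, and the Jacobi identity forces the brackets into Vergne form (`exists_isVergnePair`).
Up to a common factor, the five parameters `a₁, a₂, a₄, a₅, a₆` are polynomials in the structure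
constants. Hence a homogeneous equation in them, imposed on all Vergne forms of a law, is Zariski
closed among filiform laws (`exists_isZariskiClosed_of_params`).

Genericity. Explicit changes of basis carry a Vergne law into the second family when `a₁ a₂ (2a₂² -
25a₁(a₅ + a₆)) ≠ 0`. When `a₁ = 0`, they carry it into the first family if `a₄ (a₂ + a₄) (3a₄(a₂ +
a₄)a₅ - (2a₂² + 5a₂a₄ + 5a₄²)a₆) ≠ 0`. The members of the families satisfy these conditions, so the
family orbits are open: in all filiform laws for the second, in the orbit of the first component for
the first.

Lines. Each component is a linear space of laws. The line from any of its points to a family member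
leaves the open orbit only finitely often, which gives density (`mem_of_line`, `closure_of_family`).
For the reverse inclusion, the equations `a₁ = 0` and `5a₄ + 2a₂ = 0` define closed sets containing
the respective family orbits. An open orbit meeting a component would contain a family member, hence
infinitely many members of that family, since they form a line; but distinct members are not
isomorphic (`lawOne_injective`, `lawTwo_injective`, `not_isRigidIn_of_family`). -/

/-! ### Bilinearity of the bracket and coordinate-free Lie axioms. -/

section BracketAlgebra

variable {K : Type*} [Field K]

theorem bracket_add_right (c : StructConst K) (x y y' : Fin 8 → K) :
    bracket c x (y + y') = bracket c x y + bracket c x y' := by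
  funext k
  simp only [bracket, Pi.add_apply, mul_add, add_mul, Finset.sum_add_distrib]

theorem bracket_smul_right (c : StructConst K) (r : K) (x y : Fin 8 → K) :
    bracket c x (r • y) = r • bracket c x y := by
  funext k
  simp only [bracket, Pi.smul_apply, smul_eq_mul, Finset.mul_sum]
  refine Finset.sum_congr rfl fun i _ => Finset.sum_congr rfl fun j _ => ?_
  ring

/-- The bracket as a bilinear map. -/
def bracketBilin (c : StructConst K) : (Fin 8 → K) →ₗ[K] (Fin 8 → K) →ₗ[K] (Fin 8 → K) :=
  LinearMap.mk₂ K (bracket c) (bracket_add_left c) (bracket_smul_left c)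
    (bracket_add_right c) fun r x y => bracket_smul_right c r x y

@[simp] theorem bracketBilin_apply (c : StructConst K) (x y : Fin 8 → K) :
    bracketBilin c x y = bracket c x y := rfl

theorem bracket_zero_right (c : StructConst K) (x : Fin 8 → K) : bracket c x 0 = 0 :=
  map_zero (bracketBilin c x)

theorem bracket_sub_left (c : StructConst K) (x x' y : Fin 8 → K) :
    bracket c (x - x') y = bracket c x y - bracket c x' y :=
  LinearMap.map_sub₂ (bracketBilin c) x x' y

theorem bracket_sub_right (c : StructConst K) (x y y' : Fin 8 → K) :
    bracket c x (y - y') = bracket c x y - bracket c x y' :=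
  map_sub (bracketBilin c x) y y'

theorem bracket_basisVec (c : StructConst K) (i j : Fin 8) :
    bracket c (basisVec K i) (basisVec K j) = fun k => c (i, j, k) := by
  funext k
  simp [bracket, basisVec, Pi.single_apply]

theorem bracketBilin_ext {c : StructConst K} {B : (Fin 8 → K) →ₗ[K] (Fin 8 → K) →ₗ[K] (Fin 8 → K)}
    (h : ∀ i j, bracket c (basisVec K i) (basisVec K j) = B (basisVec K i) (basisVec K j))
    (x y : Fin 8 → K) : bracket c x y = B x y := by
  have : bracketBilin c = B := by
    refine (Pi.basisFun K (Fin 8)).ext fun i => (Pi.basisFun K (Fin 8)).ext fun j => ?_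
    simpa [basisVec] using h i j
  rw [← this, bracketBilin_apply]

theorem structConst_ext {c d : StructConst K}
    (h : ∀ x y, bracket c x y = bracket d x y) : c = d := by
  funext ⟨i, j, k⟩
  have := congrFun (h (basisVec K i) (basisVec K j)) k
  simpa [bracket_basisVec] using this

/-- Membership in the variety of Lie algebras, in terms of the bracket of arbitrary vectors. -/
theorem mem_LieVar_iff {c : StructConst K} : c ∈ LieVar K ↔
    (∀ x y, bracket c x y = -bracket c y x) ∧
    ∀ x y z, bracket c (bracket c x y) z + bracket c (bracket c y z) x
      + bracket c (bracket c z x) y = 0 := by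
  have key : ∀ i j k s, (bracket c (bracket c (basisVec K i) (basisVec K j)) (basisVec K k)) s
      = ∑ l, c (i, j, l) * c (l, k, s) := by
    intro i j k s
    rw [bracket_basisVec]
    simp [bracket, basisVec, Pi.single_apply]
  constructor
  · rintro ⟨h1, h2⟩
    constructor
    · intro x y
      have := bracketBilin_ext (c := c) (B := -(bracketBilin c).flip) (fun i j => by
        simp only [LinearMap.neg_apply, LinearMap.flip_apply, bracketBilin_apply, bracket_basisVec]
        funext k
        exact h1 i j k) x y
      simpa using this
    · have hJ : ∀ i j k, bracket c (bracket c (basisVec K i) (basisVec K j)) (basisVec K k)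
          + bracket c (bracket c (basisVec K j) (basisVec K k)) (basisVec K i)
          + bracket c (bracket c (basisVec K k) (basisVec K i)) (basisVec K j) = 0 := by
        intro i j k
        funext s
        simp only [Pi.add_apply, key, Pi.zero_apply, ← h2 i j k s, Finset.sum_add_distrib]
      have ext0 : ∀ f : (Fin 8 → K) →ₗ[K] (Fin 8 → K), (∀ i, f (basisVec K i) = 0) →
          ∀ x, f x = 0 := by
        intro f hf x
        have : f = 0 := (Pi.basisFun K (Fin 8)).ext fun i => by simpa [basisVec] using hf i
        simp [this]
      let B := bracketBilin c
      -- The Jacobi sum as a linear map of one argument; its cyclic symmetry lets the same map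
      -- extend the identity from basis vectors in each argument in turn.
      let T : (Fin 8 → K) → (Fin 8 → K) → (Fin 8 → K) →ₗ[K] (Fin 8 → K) := fun y z =>
        B.flip z ∘ₗ B.flip y + B (B y z) + B.flip y ∘ₗ B z
      have hT : ∀ x y z, T y z x = bracket c (bracket c x y) z + bracket c (bracket c y z) x
        + bracket c (bracket c z x) y := fun x y z => rfl
      have s1 : ∀ x j k, T (basisVec K j) (basisVec K k) x = 0 := fun x j k =>
        ext0 _ (fun i => by rw [hT]; exact hJ i j k) x
      have s2 : ∀ x y k, T x (basisVec K k) y = 0 := fun x y k =>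
        ext0 (T x (basisVec K k)) (fun j => by
          have := s1 x k j
          rw [hT] at this ⊢
          rw [← this]; abel) y
      intro x y z
      have := ext0 (T x y) (fun k => by
          have := s2 y x k
          rw [hT] at this ⊢
          rw [← this]; abel) z
      rw [hT] at this
      rw [← this]; abel
  · rintro ⟨h1, h2⟩
    constructor
    · intro i j k
      have := congrFun (h1 (basisVec K i) (basisVec K j)) k
      simpa [bracket_basisVec] using this
    · intro i j k s
      have := congrFun (h2 (basisVec K i) (basisVec K j) (basisVec K k)) s
      simpa only [Pi.add_apply, key, ← Finset.sum_add_distrib, Pi.zero_apply] using this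

end BracketAlgebra

/-! ### Isomorphism classes and isomorphism invariance of filiformity. -/

section Orbits

variable {K : Type*} [Field K]

theorem mem_lawOrbit_self (c : StructConst K) : c ∈ lawOrbit c :=
  ⟨LinearEquiv.refl K _, fun _ _ => rfl⟩

theorem lawOrbit_symm {c d : StructConst K} (h : d ∈ lawOrbit c) : c ∈ lawOrbit d := by
  obtain ⟨g, hg⟩ := h
  refine ⟨g.symm, fun x y => ?_⟩
  rw [LinearEquiv.eq_symm_apply, ← hg]
  simp

theorem lawOrbit_trans {c d e : StructConst K} (h : d ∈ lawOrbit c) (h' : e ∈ lawOrbit d) :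
    e ∈ lawOrbit c := by
  obtain ⟨g, hg⟩ := h
  obtain ⟨g', hg'⟩ := h'
  exact ⟨g.trans g', fun x y => by simp [hg', hg]⟩

theorem subset_familyOrbit (F : Set (StructConst K)) : F ⊆ familyOrbit F :=
  fun c hc => ⟨c, hc, mem_lawOrbit_self c⟩

theorem LieVar_of_mem_lawOrbit {c d : StructConst K} (h : d ∈ lawOrbit c) (hc : c ∈ LieVar K) :
    d ∈ LieVar K := by
  obtain ⟨g, hg⟩ := lawOrbit_symm h
  rw [mem_LieVar_iff] at hc ⊢
  refine ⟨fun x y => g.injective ?_, fun x y z => g.injective ?_⟩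
  · rw [map_neg, ← hg, ← hg, hc.1]
  · simp only [map_add, ← hg, map_zero, hc.2]

theorem mem_ascSeries_succ {c : StructConst K} {i : ℕ} {x : Fin 8 → K} :
    x ∈ ascSeries c (i + 1) ↔ ∀ y, bracket c x y ∈ ascSeries c i := Iff.rfl

theorem ascSeries_map {c d : StructConst K} {g : (Fin 8 → K) ≃ₗ[K] (Fin 8 → K)}
    (hg : ∀ x y, bracket d (g x) (g y) = g (bracket c x y)) (i : ℕ) :
    ∀ x, g x ∈ ascSeries d i ↔ x ∈ ascSeries c i := by
  induction i with
  | zero =>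
    intro x
    change g x ∈ (⊥ : Submodule K (Fin 8 → K)) ↔ x ∈ (⊥ : Submodule K (Fin 8 → K))
    simp
  | succ i ih =>
    intro x
    rw [mem_ascSeries_succ, mem_ascSeries_succ, g.surjective.forall]
    simp only [hg, ih]

theorem FilVar_of_mem_lawOrbit {c d : StructConst K} (h : d ∈ lawOrbit c) (hc : c ∈ FilVar K) :
    d ∈ FilVar K := by
  obtain ⟨⟨h1, m, hm⟩, h2⟩ := hc
  refine ⟨⟨LieVar_of_mem_lawOrbit h h1, m, ?_⟩, fun i hi => ?_⟩
  · obtain ⟨g, hg⟩ := h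
    rw [Submodule.eq_top_iff', g.surjective.forall]
    intro x
    rw [ascSeries_map hg, hm]
    trivial
  · obtain ⟨g, hg⟩ := h
    have : ascSeries d i = (ascSeries c i).map g.toLinearMap := by
      ext x
      obtain ⟨x, rfl⟩ := g.surjective x
      rw [ascSeries_map hg]
      simp
    rw [this]
    exact (LinearEquiv.finrank_map_eq g _).trans (h2 i hi)

end Orbits

/-! ### Polynomial functions, closed sets and lines. -/

section Zariski

variable {K : Type*} [Field K]

/-- A function on the space of structure constants that is given by a polynomial. -/
def IsPolyFun (f : StructConst K → K) : Prop :=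
  ∃ p : MvPolynomial (Fin 8 × Fin 8 × Fin 8) K, ∀ c, MvPolynomial.eval c p = f c

theorem IsPolyFun.const (r : K) : IsPolyFun fun _ => r := ⟨MvPolynomial.C r, by simp⟩

theorem IsPolyFun.coord (i : Fin 8 × Fin 8 × Fin 8) : IsPolyFun fun c : StructConst K => c i :=
  ⟨MvPolynomial.X i, by simp⟩

theorem IsPolyFun.add {f g : StructConst K → K} (hf : IsPolyFun f) (hg : IsPolyFun g) :
    IsPolyFun fun c => f c + g c := by
  obtain ⟨p, hp⟩ := hf
  obtain ⟨q, hq⟩ := hg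
  exact ⟨p + q, fun c => by simp [hp, hq]⟩

theorem IsPolyFun.sub {f g : StructConst K → K} (hf : IsPolyFun f) (hg : IsPolyFun g) :
    IsPolyFun fun c => f c - g c := by
  obtain ⟨p, hp⟩ := hf
  obtain ⟨q, hq⟩ := hg
  exact ⟨p - q, fun c => by simp [hp, hq]⟩

theorem IsPolyFun.mul {f g : StructConst K → K} (hf : IsPolyFun f) (hg : IsPolyFun g) :
    IsPolyFun fun c => f c * g c := by
  obtain ⟨p, hp⟩ := hf
  obtain ⟨q, hq⟩ := hg
  exact ⟨p * q, fun c => by simp [hp, hq]⟩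

theorem IsPolyFun.pow {f : StructConst K → K} (hf : IsPolyFun f) (n : ℕ) :
    IsPolyFun fun c => f c ^ n := by
  obtain ⟨p, hp⟩ := hf
  exact ⟨p ^ n, fun c => by simp [hp]⟩

theorem IsPolyFun.sum {ι : Type*} (s : Finset ι) {f : ι → StructConst K → K}
    (hf : ∀ i, IsPolyFun (f i)) : IsPolyFun fun c => ∑ i ∈ s, f i c := by
  choose p hp using hf
  exact ⟨∑ i ∈ s, p i, fun c => by simp [hp]⟩

theorem IsPolyFun.bracket {f g : StructConst K → Fin 8 → K} (hf : ∀ i, IsPolyFun fun c => f c i)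
    (hg : ∀ i, IsPolyFun fun c => g c i) (k : Fin 8) :
    IsPolyFun fun c => bracket c (f c) (g c) k :=
  IsPolyFun.sum _ fun i => IsPolyFun.sum _ fun j => ((hf i).mul (hg j)).mul (IsPolyFun.coord _)

theorem isZariskiClosed_of_isPolyFun {ι : Type*} {f : ι → StructConst K → K}
    (hf : ∀ i, IsPolyFun (f i)) : IsZariskiClosed {c | ∀ i, f i c = 0} := by
  choose p hp using hf
  refine ⟨Ideal.span (Set.range p), ?_⟩
  rw [MvPolynomial.zeroLocus_span]
  ext c
  simp [MvPolynomial.aeval_eq_eval, hp]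

open Classical in
/-- A line that is not contained in a closed set meets it in finitely many points only. -/
theorem IsZariskiClosed.finite_line {Z : Set (StructConst K)} (hZ : IsZariskiClosed Z)
    {c d : StructConst K} {s₀ : K} (h : c + s₀ • (d - c) ∉ Z) :
    {s : K | c + s • (d - c) ∈ Z}.Finite := by
  obtain ⟨I, rfl⟩ := hZ
  simp only [MvPolynomial.mem_zeroLocus_iff, not_forall] at h
  obtain ⟨p, hp, hne⟩ := h
  -- The restriction to the line of an equation of `Z` not vanishing at `s₀`: a nonzero polynomial
  -- in one variable, with finitely many roots.
  let q : Polynomial K :=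
    MvPolynomial.aeval (fun i => Polynomial.C (c i) + Polynomial.X * Polynomial.C (d i - c i)) p
  have hq : ∀ s, q.eval s = MvPolynomial.aeval (c + s • (d - c)) p := by
    intro s
    have := MvPolynomial.comp_aeval_apply
      (fun i => Polynomial.C (c i) + Polynomial.X * Polynomial.C (d i - c i))
      (Polynomial.aeval s) p
    rw [Polynomial.coe_aeval_eq_eval] at this
    rw [this]
    congr 2
    funext i
    simp
  have hq0 : q ≠ 0 := by
    intro h0
    apply hne
    rw [← hq, h0, Polynomial.eval_zero]
  refine (q.roots.toFinset.finite_toSet).subset fun s hs => ?_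
  simp only [Finset.mem_coe, Multiset.mem_toFinset, Polynomial.mem_roots hq0, Polynomial.IsRoot]
  rw [hq]
  exact (MvPolynomial.mem_zeroLocus_iff.mp hs) p hp

theorem IsZariskiOpenIn.mono {V V' S : Set (StructConst K)} (h : IsZariskiOpenIn V (S ∩ V))
    (hV : V' ⊆ V) : IsZariskiOpenIn V' (S ∩ V') := by
  obtain ⟨Z, hZ, h⟩ := h
  refine ⟨Z, hZ, ?_⟩
  ext c
  constructor
  · rintro ⟨hc, hc'⟩
    have : c ∈ V \ Z := h ▸ ⟨hc, hV hc'⟩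
    exact ⟨hc', this.2⟩
  · rintro ⟨hc', hc⟩
    have : c ∈ S ∩ V := h ▸ ⟨hV hc', hc⟩
    exact ⟨this.1, hc'⟩

/-- The linear action of `GL(8, K)` on structure constants. -/
theorem exists_action (g : (Fin 8 → K) ≃ₗ[K] (Fin 8 → K)) :
    ∃ A : StructConst K →ₗ[K] StructConst K,
      ∀ c x y, bracket (A c) (g x) (g y) = g (bracket c x y) := by
  have hb : ∀ x y k (c c' : StructConst K), bracket (c + c') x y k
      = bracket c x y k + bracket c' x y k := by
    intro x y k c c'
    simp [bracket, mul_add, Finset.sum_add_distrib]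
  have hs : ∀ x y k (r : K) (c : StructConst K), bracket (r • c) x y k
      = r * bracket c x y k := by
    intro x y k r c
    simp only [bracket, Pi.smul_apply, smul_eq_mul, Finset.mul_sum]
    refine Finset.sum_congr rfl fun i _ => Finset.sum_congr rfl fun j _ => ?_
    ring
  refine ⟨{ toFun := fun c p => g (bracket c (g.symm (basisVec K p.1))
              (g.symm (basisVec K p.2.1))) p.2.2
            map_add' := fun c c' => ?_
            map_smul' := fun r c => ?_ }, fun c x y => ?_⟩
  · funext p
    rw [Pi.add_apply, ← Pi.add_apply (g _) (g _), ← map_add]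
    refine congrArg (fun v => g v p.2.2) (funext fun k => ?_)
    simp [hb]
  · funext p
    rw [RingHom.id_apply, Pi.smul_apply, ← Pi.smul_apply r (g _), ← map_smul]
    refine congrArg (fun v => g v p.2.2) (funext fun k => ?_)
    simp [hs]
  · have := bracketBilin_ext (c := fun p => g (bracket c (g.symm (basisVec K p.1))
              (g.symm (basisVec K p.2.1))) p.2.2)
      (B := ((bracketBilin c).compl₁₂ g.symm.toLinearMap g.symm.toLinearMap).compr₂ g.toLinearMap)
      (fun i j => by
        rw [bracket_basisVec]
        simp) (g x) (g y)
    simpa using this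

/-- A fixed `g` acts linearly on structure constants, so it maps lines of laws to lines of laws.
This moves density arguments from Vergne laws to whole orbits. -/
theorem line_mem_lawOrbit {c c' d d' : StructConst K} {g : (Fin 8 → K) ≃ₗ[K] (Fin 8 → K)}
    (hc : ∀ x y, bracket c' (g x) (g y) = g (bracket c x y))
    (hd : ∀ x y, bracket d' (g x) (g y) = g (bracket d x y)) (s : K) :
    c' + s • (d' - c') ∈ lawOrbit (c + s • (d - c)) := by
  obtain ⟨A, hA⟩ := exists_action g
  have aux : ∀ {b b' : StructConst K}, (∀ x y, bracket b' (g x) (g y) = g (bracket b x y)) →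
      b' = A b := by
    intro b b' hb
    apply structConst_ext
    intro x y
    obtain ⟨x, rfl⟩ := g.surjective x
    obtain ⟨y, rfl⟩ := g.surjective y
    rw [hb, hA]
  rw [aux hc, aux hd]
  refine ⟨g, fun x y => ?_⟩
  rw [← hA, map_add, map_smul, map_sub]

end Zariski

/-! ### Vergne laws in coordinates and their Jacobi identity. -/

section VergneBracket

variable {K : Type*} [Field K]

set_option maxHeartbeats 2000000 in
/-- The bracket of two arbitrary vectors for a law in Vergne form. -/
theorem bracket_vergneLaw (a₁ a₂ a₄ a₅ a₆ a₇ a₈ : K) (x y : Fin 8 → K) :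
    bracket (vergneLaw a₁ a₂ a₄ a₅ a₆ a₇ a₈) x y =
      ![0, 0, x 0 * y 1 - x 1 * y 0,
        (x 0 * y 2 - x 2 * y 0) + a₁ * (x 1 * y 2 - x 2 * y 1),
        (x 0 * y 3 - x 3 * y 0) + a₁ * (x 1 * y 3 - x 3 * y 1)
          + (a₂ + 2 * a₄) * (x 1 * y 2 - x 2 * y 1),
        (x 0 * y 4 - x 4 * y 0) + a₁ * (x 1 * y 4 - x 4 * y 1)
          + (a₂ + 2 * a₄) * (x 1 * y 3 - x 3 * y 1) + (a₅ + a₆) * (x 1 * y 2 - x 2 * y 1),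
        (x 0 * y 5 - x 5 * y 0) + a₁ * (x 1 * y 5 - x 5 * y 1)
          + (a₂ + a₄) * (x 1 * y 4 - x 4 * y 1) + a₄ * (x 2 * y 3 - x 3 * y 2)
          + (a₅ + a₆) * (x 1 * y 3 - x 3 * y 1) + a₇ * (x 1 * y 2 - x 2 * y 1),
        (x 0 * y 6 - x 6 * y 0) + a₁ * (x 2 * y 5 - x 5 * y 2) + a₂ * (x 1 * y 5 - x 5 * y 1)
          - a₁ * (x 3 * y 4 - x 4 * y 3) + a₄ * (x 2 * y 4 - x 4 * y 2)
          + a₅ * (x 1 * y 4 - x 4 * y 1) + a₆ * (x 2 * y 3 - x 3 * y 2)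
          + a₇ * (x 1 * y 3 - x 3 * y 1) + a₈ * (x 1 * y 2 - x 2 * y 1)] := by
  funext k
  fin_cases k <;>
  · simp [bracket, Fin.sum_univ_eight, vergneLaw, vergneUpper, basisVec]
    try ring

theorem vergneLaw_mem_LieVar {a₁ a₂ a₄ a₅ a₆ a₇ a₈ : K} (h : a₁ * (5 * a₄ + 2 * a₂) = 0) :
    vergneLaw a₁ a₂ a₄ a₅ a₆ a₇ a₈ ∈ LieVar K := by
  rw [mem_LieVar_iff]
  constructor
  · intro x y
    simp only [bracket_vergneLaw]
    funext k
    fin_cases k <;> simp <;> ring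
  · intro x y z
    simp only [bracket_vergneLaw]
    funext k
    fin_cases k
    · simp
    · simp
    · simp
    · simp; ring
    · simp; ring
    · simp; ring
    · simp; ring
    · simp
      -- The only obstruction sits in the `X 7` coordinate: the determinant of the coordinates 1, 2,
      -- 3 of `x, y, z`, times `a₁ (5a₄ + 2a₂)`.
      linear_combination (x 1 * (y 2 * z 3 - y 3 * z 2) - y 1 * (x 2 * z 3 - x 3 * z 2)
        + z 1 * (x 2 * y 3 - x 3 * y 2)) * h

end VergneBracket

/-! ### Vergne laws are filiform. -/

section VergneFiliform

variable {K : Type*} [Field K]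

/-- The span of the last `i` basis vectors. -/
def tailSpan (K : Type*) [Field K] (i : ℕ) : Submodule K (Fin 8 → K) :=
  ⨅ k ∈ {k : Fin 8 | k.val < 8 - i}, LinearMap.ker (LinearMap.proj k)

theorem mem_tailSpan {i : ℕ} {x : Fin 8 → K} :
    x ∈ tailSpan K i ↔ ∀ k : Fin 8, k.val < 8 - i → x k = 0 := by
  simp [tailSpan, Submodule.mem_iInf]

theorem finrank_tailSpan {i : ℕ} (hi : i ≤ 8) : Module.finrank K (tailSpan K i) = i := by
  classical
  have e := LinearMap.iInfKerProjEquiv K (fun _ : Fin 8 => K)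
    (I := {k : Fin 8 | 8 - i ≤ k.val}) (J := {k : Fin 8 | k.val < 8 - i})
    (by
      rw [Set.disjoint_left]
      intro k hk hk'
      simp only [Set.mem_ofPred_eq] at hk hk'
      omega)
    (by
      intro k _
      simp only [Set.mem_union, Set.mem_ofPred_eq]
      omega)
  rw [tailSpan, LinearEquiv.finrank_eq e, Module.finrank_fintype_fun_eq_card]
  interval_cases i <;> simp <;> decide

theorem ascSeries_vergneLaw {a₁ a₂ a₄ a₅ a₆ a₇ a₈ : K} {i : ℕ} (hi : i ≤ 6) :
    ascSeries (vergneLaw a₁ a₂ a₄ a₅ a₆ a₇ a₈) i = tailSpan K i := by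
  induction i with
  | zero =>
    ext x
    change x ∈ (⊥ : Submodule K (Fin 8 → K)) ↔ _
    rw [mem_tailSpan, Submodule.mem_bot, funext_iff]
    exact forall_congr' fun k => ⟨fun h _ => h, fun h => h (by omega)⟩
  | succ i ih =>
    ext x
    simp only [mem_ascSeries_succ, ih (by omega), mem_tailSpan, bracket_vergneLaw]
    constructor
    · intro h
      -- Bracketing with `X 0` shifts coordinates by one and so controls `x k` for `k ≥ 1`; the
      -- coordinate `x 0` is read off from the bracket with `X 1`.
      have h0 := h (basisVec K 0)
      have h1 := h (basisVec K 1) 2 (by simp; omega)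
      simp [basisVec] at h1
      intro k hk
      have h0k := h0 (k + 1)
      fin_cases k <;> simp [basisVec, h1] at hk h0k ⊢ <;>
        first | omega | exact h0k (by omega)
    · intro h y k hk
      have h0 := h 0 (by simp; omega)
      have h1 := h 1 (by simp; omega)
      have h2 := h 2
      have h3 := h 3
      have h4 := h 4
      have h5 := h 5
      have h6 := h 6
      simp at h2 h3 h4 h5 h6
      have e2 : 2 < 7 - i → x 2 = 0 := fun q => h2 (by omega)
      have e3 : 3 < 7 - i → x 3 = 0 := fun q => h3 (by omega)
      have e4 : 4 < 7 - i → x 4 = 0 := fun q => h4 (by omega)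
      have e5 : 5 < 7 - i → x 5 = 0 := fun q => h5 (by omega)
      have e6 : 6 < 7 - i → x 6 = 0 := fun q => h6 (by omega)
      clear h h2 h3 h4 h5 h6 ih
      fin_cases k <;> simp [h0, h1] at hk ⊢
      · rw [e2 (by omega)]; ring
      · rw [e2 (by omega), e3 (by omega)]; ring
      · rw [e2 (by omega), e3 (by omega), e4 (by omega)]; ring
      · rw [e2 (by omega), e3 (by omega), e4 (by omega), e5 (by omega)]; ring
      · rw [e2 (by omega), e3 (by omega), e4 (by omega), e5 (by omega), e6 (by omega)]; ring

theorem vergneLaw_mem_FilVar {a₁ a₂ a₄ a₅ a₆ a₇ a₈ : K} (h : a₁ * (5 * a₄ + 2 * a₂) = 0) :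
    vergneLaw a₁ a₂ a₄ a₅ a₆ a₇ a₈ ∈ FilVar K := by
  refine ⟨⟨vergneLaw_mem_LieVar h, 7, ?_⟩, fun i hi => ?_⟩
  · rw [Submodule.eq_top_iff']
    intro x
    rw [mem_ascSeries_succ]
    intro y
    rw [ascSeries_vergneLaw le_rfl, mem_tailSpan, bracket_vergneLaw]
    intro k hk
    fin_cases k <;> simp at hk ⊢
  · rw [ascSeries_vergneLaw hi, finrank_tailSpan (by omega)]

end VergneFiliform

/-! ### Existence of Vergne bases in filiform algebras. -/

section Structure

set_option linter.unusedSimpArgs false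

variable {K : Type*} [Field K]

theorem ascSeries_le_succ {d : StructConst K} (i : ℕ) :
    ascSeries d i ≤ ascSeries d (i + 1) := by
  induction i with
  | zero => exact bot_le
  | succ i ih => exact fun x hx y => ih (hx y)

/-- Nilpotency makes `C₇` strictly larger than `C₆`. It cannot have dimension 7, because the centre
of a Lie algebra (here the quotient by `C₆`) never has codimension one: a complementary vector `x`
commutes with itself and, modulo `C₆`, with `C₇`, so it would be central too. -/
theorem ascSeries_seven {d : StructConst K} (hd : d ∈ FilVar K) [CharZero K] :
    ascSeries d 7 = ⊤ := by
  obtain ⟨⟨hL, m, hm⟩, hfin⟩ := hd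
  have hmono : Monotone (ascSeries d) := monotone_nat_of_le_succ ascSeries_le_succ
  have hne : ascSeries d 6 ≠ ascSeries d 7 := by
    intro h
    have hst : ∀ n, ascSeries d (6 + n) = ascSeries d 6 := by
      intro n
      induction n with
      | zero => rfl
      | succ n ih =>
        ext x
        rw [← add_assoc, mem_ascSeries_succ, ih]
        conv_rhs => rw [h]
        rfl
    have htop : ascSeries d 6 = ⊤ := by
      rw [← hst m, eq_top_iff, ← hm]
      exact hmono (by omega)
    have := hfin 6 le_rfl
    rw [htop, finrank_top, Module.finrank_fin_fun] at this
    omega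
  have hlt : Module.finrank K (ascSeries d 6) < Module.finrank K (ascSeries d 7) :=
    Submodule.finrank_lt_finrank_of_lt (lt_of_le_of_ne (ascSeries_le_succ 6) hne)
  by_contra htop
  have hlt' := Submodule.finrank_lt_finrank_of_lt (lt_top_iff_ne_top.mpr htop)
  rw [finrank_top, Module.finrank_fin_fun] at hlt'
  rw [hfin 6 le_rfl] at hlt
  obtain ⟨x, hx⟩ : ∃ x, x ∉ ascSeries d 7 := by
    by_contra! h
    exact htop (Submodule.eq_top_iff'.mpr h)
  have hskew := (mem_LieVar_iff.mp hL).1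
  have hself : bracket d x x = 0 := by
    have := hskew x x
    rwa [self_eq_neg] at this
  have hsup : ascSeries d 7 ⊔ Submodule.span K {x} = ⊤ := by
    apply Submodule.eq_top_of_finrank_eq
    rw [Module.finrank_fin_fun]
    have : ascSeries d 7 < ascSeries d 7 ⊔ Submodule.span K {x} := by
      refine lt_of_le_of_ne le_sup_left fun h => hx ?_
      rw [h]
      exact Submodule.mem_sup_right (Submodule.mem_span_singleton_self x)
    have h1 := Submodule.finrank_lt_finrank_of_lt this
    have h2 := Submodule.finrank_le (ascSeries d 7 ⊔ Submodule.span K {x})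
    rw [Module.finrank_fin_fun] at h2
    omega
  apply hx
  rw [mem_ascSeries_succ]
  intro y
  obtain ⟨u, hu, w, hw, rfl⟩ := Submodule.mem_sup.mp (hsup ▸ Submodule.mem_top : y ∈ _)
  obtain ⟨r, rfl⟩ := Submodule.mem_span_singleton.mp hw
  rw [bracket_add_right, bracket_smul_right, hself, smul_zero, add_zero, hskew]
  exact neg_mem (hu x)

theorem exists_sub_smul_mem {V : Type*} [AddCommGroup V] [Module K V] [FiniteDimensional K V]
    {A B : Submodule K V} (hAB : A ≤ B)
    (hr : Module.finrank K B = Module.finrank K A + 1) {e z : V} (he : e ∈ B) (he' : e ∉ A)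
    (hz : z ∈ B) : ∃ t : K, z - t • e ∈ A := by
  have hlt : A < A ⊔ Submodule.span K {e} := by
    refine lt_of_le_of_ne le_sup_left fun h => he' ?_
    rw [h]
    exact Submodule.mem_sup_right (Submodule.mem_span_singleton_self e)
  have hle : A ⊔ Submodule.span K {e} ≤ B :=
    sup_le hAB ((Submodule.span_singleton_le_iff_mem _ _).mpr he)
  have heq : A ⊔ Submodule.span K {e} = B := by
    apply Submodule.eq_of_le_of_finrank_le hle
    have := Submodule.finrank_lt_finrank_of_lt hlt
    omega
  obtain ⟨u, hu, w, hw, rfl⟩ := Submodule.mem_sup.mp (heq ▸ hz : z ∈ _)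
  obtain ⟨r, rfl⟩ := Submodule.mem_span_singleton.mp hw
  exact ⟨r, by simpa using hu⟩

/-- The vectors `x, y` are the first two members of a basis of `K⁸` in which the law `d` takes the
Vergne form with the given parameters. -/
def IsVergnePair (d : StructConst K) (x y : Fin 8 → K) (a₁ a₂ a₄ a₅ a₆ a₇ a₈ : K) : Prop :=
  ∃ g : (Fin 8 → K) ≃ₗ[K] (Fin 8 → K), g (basisVec K 0) = x ∧ g (basisVec K 1) = y ∧
    ∀ u w, bracket d (g u) (g w) = g (bracket (vergneLaw a₁ a₂ a₄ a₅ a₆ a₇ a₈) u w)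

theorem IsVergnePair.mem_lawOrbit {d : StructConst K} {x y : Fin 8 → K} {a₁ a₂ a₄ a₅ a₆ a₇ a₈ : K}
    (h : IsVergnePair d x y a₁ a₂ a₄ a₅ a₆ a₇ a₈) :
    d ∈ lawOrbit (vergneLaw a₁ a₂ a₄ a₅ a₆ a₇ a₈) := by
  obtain ⟨g, -, -, hg⟩ := h
  exact ⟨g, hg⟩

/-- `ad x` applied `j` times to `y`. -/
def adIter (d : StructConst K) (x y : Fin 8 → K) : ℕ → Fin 8 → K
  | 0 => y
  | j + 1 => bracket d x (adIter d x y j)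

/-- Iterating `ad (e 0)` on a linear relation isolates the coefficients of `e 1` through `e 6`, one
after another. -/
theorem linearIndependent_chain {d : StructConst K} {e : Fin 8 → Fin 8 → K}
    (h2 : bracket d (e 0) (e 1) = e 2) (h3 : bracket d (e 0) (e 2) = e 3)
    (h4 : bracket d (e 0) (e 3) = e 4) (h5 : bracket d (e 0) (e 4) = e 5)
    (h6 : bracket d (e 0) (e 5) = e 6) (h7 : bracket d (e 0) (e 6) = e 7)
    (h00 : bracket d (e 0) (e 0) = 0)
    (h70 : bracket d (e 0) (e 7) = 0) (h71 : bracket d (e 7) (e 1) = 0) (hne : e 7 ≠ 0) :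
    LinearIndependent K e := by
  rw [Fintype.linearIndependent_iff]
  intro c hc
  rw [Fin.sum_univ_eight] at hc
  have app : ∀ {z : Fin 8 → K}, z = 0 → bracket d (e 0) z = 0 := by
    rintro z rfl
    exact bracket_zero_right d _
  have k1 := app hc
  simp only [bracket_add_right, bracket_smul_right, h00, h2, h3, h4, h5, h6, h7, h70, smul_zero,
    zero_add, add_zero] at k1
  have k2 := app k1
  simp only [bracket_add_right, bracket_smul_right, h00, h2, h3, h4, h5, h6, h7, h70, smul_zero,
    zero_add, add_zero] at k2
  have k3 := app k2
  simp only [bracket_add_right, bracket_smul_right, h00, h2, h3, h4, h5, h6, h7, h70, smul_zero,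
    zero_add, add_zero] at k3
  have k4 := app k3
  simp only [bracket_add_right, bracket_smul_right, h00, h2, h3, h4, h5, h6, h7, h70, smul_zero,
    zero_add, add_zero] at k4
  have k5 := app k4
  simp only [bracket_add_right, bracket_smul_right, h00, h2, h3, h4, h5, h6, h7, h70, smul_zero,
    zero_add, add_zero] at k5
  have k6 := app k5
  simp only [bracket_add_right, bracket_smul_right, h00, h2, h3, h4, h5, h6, h7, h70, smul_zero,
    zero_add, add_zero] at k6
  have z : ∀ {r : K}, r • e 7 = 0 → r = 0 := fun h => (smul_eq_zero.mp h).resolve_right hne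
  have c1 := z k6
  rw [c1, zero_smul, zero_add] at k5
  have c2 := z k5
  rw [c1, c2, zero_smul, zero_smul, zero_add, zero_add] at k4
  have c3 := z k4
  rw [c1, c2, c3, zero_smul, zero_smul, zero_smul, zero_add, zero_add, zero_add] at k3
  have c4 := z k3
  simp only [c1, c2, c3, c4, zero_smul, zero_add] at k2
  have c5 := z k2
  simp only [c1, c2, c3, c4, c5, zero_smul, zero_add] at k1
  have c6 := z k1
  simp only [c1, c2, c3, c4, c5, c6, zero_smul, add_zero] at hc
  -- The coefficients of `e 0` and `e 7` are invisible to `ad (e 0)`; bracketing with `e 1`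
  -- separates them.
  have k0 : bracket d (c 0 • e 0 + c 7 • e 7) (e 1) = 0 := by rw [hc, bracket_zero_left]
  rw [bracket_add_left, bracket_smul_left, bracket_smul_left, h71, h2, smul_zero, add_zero] at k0
  have he2 : e 2 ≠ 0 := by
    intro h
    apply hne
    rw [← h7, ← h6, ← h5, ← h4, ← h3, h]
    simp only [bracket_zero_right]
  have c0 := (smul_eq_zero.mp k0).resolve_right he2
  simp only [c0, zero_smul, zero_add] at hc
  have c7 := z hc
  intro i
  fin_cases i <;> assumption

/-- Since `e (8 - i), …, e 7` span `C_i`, the brackets of `e 1` with `e 2, …, e 5` expand with free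
coefficients. The derivation `ad (e 0)` determines the remaining brackets, and `[e 2, e 2] = [e 3, e
3] = 0` together with two further Jacobi identities give all the relations among those coefficients.
-/
theorem exists_isVergnePair_of_chain [CharZero K] {d : StructConst K} (hd : d ∈ FilVar K)
    {e : Fin 8 → Fin 8 → K}
    (h2 : bracket d (e 0) (e 1) = e 2) (h3 : bracket d (e 0) (e 2) = e 3)
    (h4 : bracket d (e 0) (e 3) = e 4) (h5 : bracket d (e 0) (e 4) = e 5)
    (h6 : bracket d (e 0) (e 5) = e 6) (h7 : bracket d (e 0) (e 6) = e 7)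
    (h16 : bracket d (e 1) (e 6) = 0) (hne : e 7 ≠ 0) :
    ∃ a₁ a₂ a₄ a₅ a₆ a₇ a₈ : K, a₁ * (5 * a₄ + 2 * a₂) = 0 ∧
      IsVergnePair d (e 0) (e 1) a₁ a₂ a₄ a₅ a₆ a₇ a₈ := by
  have hC7 := ascSeries_seven hd
  have hL := hd.1.1
  have hfin := hd.2
  obtain ⟨hskew, hJ⟩ := mem_LieVar_iff.mp hL
  have hself : ∀ x, bracket d x x = 0 := fun x => by
    have := hskew x x
    rwa [self_eq_neg] at this
  have hder : ∀ z u w, bracket d (bracket d z u) w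
      = bracket d z (bracket d u w) - bracket d u (bracket d z w) := by
    intro z u w
    have h := hJ z u w
    rw [hskew (bracket d u w) z, hskew (bracket d w z) u, hskew w z] at h
    have h' : bracket d u (-bracket d z w) = -bracket d u (bracket d z w) :=
      map_neg (bracketBilin d u) _
    rw [h', neg_neg] at h
    linear_combination h
  have hD := hder (e 0)
  have hin : ∀ {i x} (y), x ∈ ascSeries d (i + 1) → bracket d y x ∈ ascSeries d i := by
    intro i x y hx
    rw [hskew]
    exact neg_mem (hx y)
  -- Each `e j` with `j ≥ 2` lies in `C_{8-j}`. For `j ≥ 3` it is shown to lie outside `C_{7-j}`: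
  -- otherwise its images under `ad (e 0)` would force `e 7 = 0`.
  have m2 : e 2 ∈ ascSeries d 6 := h2 ▸ hin _ (hC7 ▸ Submodule.mem_top)
  have m3 : e 3 ∈ ascSeries d 5 := h3 ▸ hin _ m2
  have m4 : e 4 ∈ ascSeries d 4 := h4 ▸ hin _ m3
  have m5 : e 5 ∈ ascSeries d 3 := h5 ▸ hin _ m4
  have m6 : e 6 ∈ ascSeries d 2 := h6 ▸ hin _ m5
  have m7 : e 7 ∈ ascSeries d 1 := h7 ▸ hin _ m6
  have n7 : e 7 ∉ ascSeries d 0 := hne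
  have n6 : e 6 ∉ ascSeries d 1 := fun h => n7 (h7 ▸ hin _ h)
  have n5 : e 5 ∉ ascSeries d 2 := fun h => n6 (h6 ▸ hin _ h)
  have n4 : e 4 ∉ ascSeries d 3 := fun h => n5 (h5 ▸ hin _ h)
  have n3 : e 3 ∉ ascSeries d 4 := fun h => n4 (h4 ▸ hin _ h)
  have zR : ∀ y, bracket d y (e 7) = 0 := fun y => by
    have := hin y m7
    exact this
  have step : ∀ {i : ℕ} (_ : i ≤ 5) {v z : Fin 8 → K}, v ∈ ascSeries d (i + 1) →
      v ∉ ascSeries d i → z ∈ ascSeries d (i + 1) → ∃ t : K, z - t • v ∈ ascSeries d i := by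
    intro i hi v z hv hv' hz
    refine exists_sub_smul_mem (ascSeries_le_succ i) ?_ hv hv' hz
    rw [hfin i (by omega), hfin (i + 1) (by omega)]
  have s1 : ∀ {z}, z ∈ ascSeries d 1 → ∃ t : K, z = t • e 7 := fun hz => by
    obtain ⟨t, ht⟩ := step (by omega) m7 n7 hz
    exact ⟨t, sub_eq_zero.mp ht⟩
  have s2 : ∀ {z}, z ∈ ascSeries d 2 → ∃ t s : K, z = t • e 6 + s • e 7 := fun hz => by
    obtain ⟨t, ht⟩ := step (by omega) m6 n6 hz
    obtain ⟨s, hs⟩ := s1 ht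
    exact ⟨t, s, by rw [← hs]; abel⟩
  have s3 : ∀ {z}, z ∈ ascSeries d 3 → ∃ t s r : K, z = t • e 5 + s • e 6 + r • e 7 :=
    fun hz => by
    obtain ⟨t, ht⟩ := step (by omega) m5 n5 hz
    obtain ⟨s, r, hs⟩ := s2 ht
    exact ⟨t, s, r, by rw [add_assoc, ← hs]; abel⟩
  have s4 : ∀ {z}, z ∈ ascSeries d 4 → ∃ t s r q : K,
      z = t • e 4 + s • e 5 + r • e 6 + q • e 7 := fun hz => by
    obtain ⟨t, ht⟩ := step (by omega) m4 n4 hz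
    obtain ⟨s, r, q, hs⟩ := s3 ht
    exact ⟨t, s, r, q, by rw [add_assoc, add_assoc, ← add_assoc (s • _), ← hs]; abel⟩
  have s5 : ∀ {z}, z ∈ ascSeries d 5 → ∃ t s r q p : K,
      z = t • e 3 + s • e 4 + r • e 5 + q • e 6 + p • e 7 := fun hz => by
    obtain ⟨t, ht⟩ := step (by omega) m3 n3 hz
    obtain ⟨s, r, q, p, hs⟩ := s4 ht
    exact ⟨t, s, r, q, p, by
      rw [add_assoc, add_assoc, add_assoc, ← add_assoc (r • _), ← add_assoc (s • _),
        ← add_assoc (s • _), ← hs]; abel⟩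
  obtain ⟨w₁, w₂, w₃, w₄, w₅, t12⟩ := s5 (hin (e 1) m2)
  obtain ⟨v₁, v₂, v₃, v₄, t13⟩ := s4 (hin (e 1) m3)
  obtain ⟨u₁, u₂, u₃, t14⟩ := s3 (hin (e 1) m4)
  obtain ⟨p, q, t15⟩ := s2 (hin (e 1) m5)
  have li := linearIndependent_chain h2 h3 h4 h5 h6 h7 (hself _) (zR _)
    (by rw [hskew, zR, neg_zero]) hne
  have skewed : ∀ {x y z : Fin 8 → K}, bracket d x y = z → bracket d y x = -z := by
    rintro x y z rfl
    exact hskew y x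
  have coef : ∀ {t₄ t₅ t₆ t₇ : K}, t₄ • e 4 + t₅ • e 5 + t₆ • e 6 + t₇ • e 7 = 0 →
      t₄ = 0 ∧ t₅ = 0 ∧ t₆ = 0 ∧ t₇ = 0 := by
    intro t₄ t₅ t₆ t₇ h
    have := Fintype.linearIndependent_iff.mp li ![0, 0, 0, 0, t₄, t₅, t₆, t₇]
      (by simpa [Fin.sum_univ_eight] using h)
    exact ⟨this 4, this 5, this 6, this 7⟩
  have t26 := hD (e 1) (e 6)
  simp only [h2, h7, h16, zR, bracket_zero_right, sub_zero] at t26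
  have t36 := hD (e 2) (e 6)
  simp only [h3, h7, t26, zR, bracket_zero_right, sub_zero] at t36
  have t46 := hD (e 3) (e 6)
  simp only [h4, h7, t36, zR, bracket_zero_right, sub_zero] at t46
  have t56 := hD (e 4) (e 6)
  simp only [h5, h7, t46, zR, bracket_zero_right, sub_zero] at t56
  have t25 := hD (e 1) (e 5)
  simp only [h2, h6, t15, h16, bracket_add_right, bracket_smul_right, h7, zR, smul_zero, add_zero,
    sub_zero] at t25
  have t35 := hD (e 2) (e 5)
  simp only [h3, h6, t25, t26, bracket_smul_right, zR, smul_zero, sub_zero] at t35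
  have t45 := hD (e 3) (e 5)
  simp only [h4, h6, t35, t36, bracket_zero_right, sub_zero] at t45
  have t24 := hD (e 1) (e 4)
  simp only [h2, h5, t14, t15, bracket_add_right, bracket_smul_right, h6, h7, zR, smul_zero,
    add_zero] at t24
  have t34 := hD (e 2) (e 4)
  simp only [h3, h5, t24, t25, bracket_add_right, bracket_sub_right, bracket_smul_right, h6, h7,
    zR, smul_zero, add_zero] at t34
  have t23 := hD (e 1) (e 3)
  simp only [h2, h4, t13, t14, bracket_add_right, bracket_smul_right, h5, h6, h7, zR, smul_zero,
    add_zero] at t23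
  have t33 := hD (e 2) (e 3)
  simp only [h3, h4, t23, t24, hself, bracket_add_right, bracket_sub_right, bracket_smul_right, h6,
    h7, zR, smul_zero, add_zero] at t33
  obtain ⟨-, -, r₁, r₂⟩ := coef (t₄ := 0) (t₅ := 0) (t₆ := (v₁ - u₁) - (u₁ - p))
    (t₇ := (v₂ - u₂) - (u₂ - q)) (by
      rw [t33]
      module)
  have t22 := hD (e 1) (e 2)
  simp only [h2, h3, t12, t13, hself, bracket_add_right, bracket_smul_right, h4, h5, h6, h7,
    zR, smul_zero, add_zero] at t22
  obtain ⟨r₃, r₄, r₅, r₆⟩ := coef (t₄ := w₁ - v₁) (t₅ := w₂ - v₂) (t₆ := w₃ - v₃)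
    (t₇ := w₄ - v₄) (by
      rw [t22]
      module)
  have skew0 : ∀ {x y : Fin 8 → K}, bracket d x y = 0 → bracket d y x = 0 := by
    intro x y h
    rw [skewed h, neg_zero]
  -- With the linear relations `r₁` and `r₃`, this identity becomes `2 (u₁ - p)² = 0`, which merges
  -- all the leading coefficients into the single parameter `a₁`.
  have j124 := hder (e 1) (e 2) (e 4)
  simp only [t12, t24, t14, bracket_add_left, bracket_sub_left, bracket_smul_left,
    bracket_add_right, bracket_sub_right, bracket_smul_right, t34, t25, t26, h16, zR,
    hself, skew0 t45, skew0 t46, skew0 (zR _), smul_zero, add_zero, sub_zero, zero_add] at j124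
  obtain ⟨-, -, -, r₇⟩ := coef (t₄ := 0) (t₅ := 0) (t₆ := 0)
    (t₇ := w₁ * ((u₁ - p) - p) + u₁ * p) (by
      linear_combination (norm := module) j124)
  have hu : u₁ = p := by
    have h2 : (2 : K) * (u₁ - p) ^ 2 = 0 := by
      linear_combination r₇ - (u₁ - 2 * p) * (r₁ + r₃)
    have := pow_eq_zero_iff (two_ne_zero) |>.mp ((mul_eq_zero.mp h2).resolve_left two_ne_zero)
    exact sub_eq_zero.mp this
  obtain rfl : p = u₁ := hu.symm
  obtain rfl : v₁ = p := by linear_combination r₁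
  obtain rfl : w₁ = v₁ := by linear_combination r₃
  obtain rfl : w₂ = v₂ := by linear_combination r₄
  obtain rfl : w₃ = v₃ := by linear_combination r₅
  obtain rfl : w₄ = v₄ := by linear_combination r₆
  -- This identity is the source of the equation `a₁ (5a₄ + 2a₂) = 0`.
  have j123 := hder (e 1) (e 2) (e 3)
  simp only [t12, t13, t23, t14, bracket_add_left, bracket_sub_left, bracket_smul_left,
    bracket_add_right, bracket_sub_right, bracket_smul_right, t34, t25, t26, h16, zR, t15, t24,
    hself, skewed t34, skew0 t35, skew0 t36, skew0 (zR _), smul_zero, add_zero, sub_zero, zero_add]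
    at j123
  obtain ⟨-, -, -, r₈⟩ := coef (t₄ := 0) (t₅ := 0) (t₆ := 0)
    (t₇ := w₁ * (5 * (u₂ - q) + 2 * q)) (by
      obtain rfl : w₂ = 2 * u₂ - q := by linear_combination r₂
      linear_combination (norm := module) j123)
  refine ⟨w₁, q, u₂ - q, u₃, w₃ - u₃, w₄, w₅, r₈, ?_⟩
  let f := Fintype.linearCombination K e
  have finj : Function.Injective f := li.fintypeLinearCombination_injective
  have fb : ∀ i, f (basisVec K i) = e i := fun i => by
    simp [f, basisVec]
  let g := LinearEquiv.ofInjectiveEndo f finj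
  refine ⟨g, fb 0, fb 1, ?_⟩
  have htab : ∀ i j : Fin 8, i < j → bracket d (e i) (e j)
      = f (fun k => vergneLaw w₁ q (u₂ - q) u₃ (w₃ - u₃) w₄ w₅ (i, j, k)) := by
    obtain rfl : w₂ = 2 * u₂ - q := by linear_combination r₂
    have hf : ∀ x, f x = ∑ k, x k • e k := fun x => Fintype.linearCombination_apply K e x
    intro i j hij
    rw [hf, Fin.sum_univ_eight]
    fin_cases i <;> fin_cases j <;> simp [Fin.lt_def] at hij <;>
    · simp [vergneLaw, vergneUpper, basisVec, h2, h3, h4, h5, h6, h7, h16, t12, t13, t14, t15, t23,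
        t24, t25, t26, t34, t35, t36, t45, t46, t56, zR]
      try module
  have hext := bracketBilin_ext (c := vergneLaw w₁ q (u₂ - q) u₃ (w₃ - u₃) w₄ w₅)
    (B := ((bracketBilin d).compl₁₂ g.toLinearMap g.toLinearMap).compr₂ g.symm.toLinearMap)
    (by
      intro i j
      rw [bracket_basisVec]
      simp only [LinearMap.compr₂_apply, LinearMap.compl₁₂_apply, LinearEquiv.coe_coe,
        bracketBilin_apply]
      rw [LinearEquiv.eq_symm_apply]
      change f _ = bracket d (f _) (f _)
      rw [fb, fb]
      rcases lt_trichotomy i j with h | rfl | h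
      · exact (htab i j h).symm
      · rw [hself, ← map_zero f]
        congr 1
        funext k
        simp [vergneLaw]
      · rw [hskew, htab j i h, ← map_neg]
        congr 1
        funext k
        simp [vergneLaw])
  intro u w
  rw [hext]
  simp

/-- A pair `x, y` with `(ad x)⁶ y ≠ 0` and `[y, (ad x)⁵ y] = 0` generates a Vergne basis. -/
theorem exists_isVergnePair [CharZero K] {d : StructConst K} (hd : d ∈ FilVar K)
    {x y : Fin 8 → K} (h : bracket d y (adIter d x y 5) = 0) (hne : adIter d x y 6 ≠ 0) :
    ∃ a₁ a₂ a₄ a₅ a₆ a₇ a₈ : K, a₁ * (5 * a₄ + 2 * a₂) = 0 ∧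
      IsVergnePair d x y a₁ a₂ a₄ a₅ a₆ a₇ a₈ :=
  exists_isVergnePair_of_chain hd
    (e := ![x, y, adIter d x y 1, adIter d x y 2, adIter d x y 3, adIter d x y 4, adIter d x y 5,
      adIter d x y 6]) rfl rfl rfl rfl rfl rfl h hne

theorem adIter_mem_ascSeries {d : StructConst K} [CharZero K] (hd : d ∈ FilVar K)
    (x y : Fin 8 → K) {j : ℕ} (hj : j ≤ 7) : adIter d x y j ∈ ascSeries d (7 - j) := by
  have hskew := (mem_LieVar_iff.mp hd.1.1).1
  induction j with
  | zero => rw [Nat.sub_zero, ascSeries_seven hd]; trivial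
  | succ j ih =>
    have := ih (by omega)
    rw [show 7 - j = 7 - (j + 1) + 1 by omega] at this
    change bracket d x _ ∈ _
    rw [hskew]
    exact neg_mem (this x)

/-- A vector `x` outside finitely many proper subspaces maps each one-dimensional layer of the
ascending series nontrivially to the next lower one, so a suitable `y` survives six applications of
`ad x`. -/
theorem exists_adIter_six_ne_zero [CharZero K] {d : StructConst K} (hd : d ∈ FilVar K) :
    ∃ x y, adIter d x y 6 ≠ 0 := by
  obtain ⟨hskew, -⟩ := mem_LieVar_iff.mp hd.1.1
  have hlt : ∀ i ≤ 6, ∃ z ∈ ascSeries d (i + 1), z ∉ ascSeries d i := by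
    intro i hi
    by_contra! hle
    have h1 := Submodule.finrank_mono (show ascSeries d (i + 1) ≤ ascSeries d i from hle)
    rw [hd.2 i hi] at h1
    by_cases h6 : i = 6
    · subst h6
      rw [ascSeries_seven hd, finrank_top, Module.finrank_fin_fun] at h1
      omega
    · rw [hd.2 (i + 1) (by omega)] at h1
      omega
  -- The bad vectors at level `i` are those mapping `C_{i+2}` into `C_i`. If every vector were bad,
  -- then `C_{i+2}` would be contained in `C_{i+1}`.
  let W : Fin 6 → Submodule K (Fin 8 → K) := fun i =>
    ⨅ z ∈ ascSeries d (i + 2), (ascSeries d i).comap ((bracketBilin d).flip z)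
  have hW : ∀ i x, x ∈ W i ↔ ∀ z ∈ ascSeries d (i + 2), bracket d x z ∈ ascSeries d i := by
    intro i x
    simp [W, Submodule.mem_iInf]
  have hWtop : ∀ i, W i ≠ ⊤ := by
    intro i h
    obtain ⟨z, hz, hz'⟩ := hlt (i + 1) (by omega)
    apply hz'
    rw [mem_ascSeries_succ]
    intro y
    rw [hskew]
    exact neg_mem ((hW i y).mp (h ▸ Submodule.mem_top) z hz)
  obtain ⟨x, hx⟩ : ∃ x, ∀ i, x ∉ W i := by
    have := Subspace.biUnion_ne_univ_of_top_notMem (k := K) (E := Fin 8 → K)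
      (s := Finset.univ.image W) (by simpa using hWtop)
    obtain ⟨x, hx⟩ := (Set.ne_univ_iff_exists_notMem _).mp this
    exact ⟨x, by simpa using hx⟩
  have hx' : ∀ i ≤ 5, ∃ z ∈ ascSeries d (i + 2), bracket d x z ∉ ascSeries d i := by
    intro i hi
    have := hx ⟨i, by omega⟩
    rw [hW] at this
    push Not at this
    exact this
  obtain ⟨y, -, hy⟩ := hx' 5 le_rfl
  refine ⟨x, y, ?_⟩
  have key : ∀ j ≤ 5, adIter d x y (j + 1) ∉ ascSeries d (5 - j) := by
    intro j hj
    induction j with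
    | zero => exact hy
    | succ j ih =>
      intro hmem
      obtain ⟨z, hz, hz'⟩ := hx' (5 - (j + 1)) (by omega)
      rw [show 5 - (j + 1) + 2 = 5 - j + 1 by omega] at hz
      have hj1 := adIter_mem_ascSeries hd x y (j := j + 1) (by omega)
      rw [show 7 - (j + 1) = 5 - j + 1 by omega] at hj1
      obtain ⟨t, ht⟩ := exists_sub_smul_mem (ascSeries_le_succ (5 - j))
        (by rw [hd.2 _ (by omega), hd.2 _ (by omega)]) hj1 (ih (by omega)) hz
      apply hz'
      have h1 : bracket d x (z - t • adIter d x y (j + 1)) ∈ ascSeries d (5 - (j + 1)) := by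
        rw [hskew]
        rw [show 5 - j = 5 - (j + 1) + 1 by omega] at ht
        exact neg_mem (ht x)
      rw [bracket_sub_right, bracket_smul_right] at h1
      have := add_mem h1 (Submodule.smul_mem _ t hmem)
      simpa [adIter] using this
  exact key 5 le_rfl

end Structure

/-! ### Parameters as polynomial functions of the law. -/

section Parameters

variable {K : Type*} [Field K]

/-- The relations between the members of a Vergne basis generated by `x, y`. -/
structure VergneRelations (d : StructConst K) (x y : Fin 8 → K) (a₁ a₂ a₄ a₅ a₆ a₇ a₈ : K) :
    Prop where
  ne_zero : adIter d x y 6 ≠ 0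
  rel₁₆ : bracket d y (adIter d x y 5) = 0
  rel₂₅ : bracket d (adIter d x y 1) (adIter d x y 4) = a₁ • adIter d x y 6
  rel₁₅ : bracket d y (adIter d x y 4) = a₁ • adIter d x y 5 + a₂ • adIter d x y 6
  rel₂₄ : bracket d (adIter d x y 1) (adIter d x y 3) = a₄ • adIter d x y 6
  rel₁₄ : bracket d y (adIter d x y 3)
    = a₁ • adIter d x y 4 + (a₂ + a₄) • adIter d x y 5 + a₅ • adIter d x y 6
  rel₂₃ : bracket d (adIter d x y 1) (adIter d x y 2)
    = a₄ • adIter d x y 5 + a₆ • adIter d x y 6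
  rel₁₃ : bracket d y (adIter d x y 2) = a₁ • adIter d x y 3 + (a₂ + 2 * a₄) • adIter d x y 4
    + (a₅ + a₆) • adIter d x y 5 + a₇ • adIter d x y 6
  rel₁₂ : bracket d y (adIter d x y 1) = a₁ • adIter d x y 2 + (a₂ + 2 * a₄) • adIter d x y 3
    + (a₅ + a₆) • adIter d x y 4 + a₇ • adIter d x y 5 + a₈ • adIter d x y 6

theorem adIter_map {c d : StructConst K} {g : (Fin 8 → K) ≃ₗ[K] (Fin 8 → K)}
    (hg : ∀ u w, bracket d (g u) (g w) = g (bracket c u w)) (u w : Fin 8 → K) (j : ℕ) :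
    adIter d (g u) (g w) j = g (adIter c u w j) := by
  induction j with
  | zero => rfl
  | succ j ih => rw [adIter, ih, hg, adIter]

theorem adIter_smul (d : StructConst K) (x y : Fin 8 → K) (r : K) (j : ℕ) :
    adIter d x (r • y) j = r • adIter d x y j := by
  induction j with
  | zero => rfl
  | succ j ih => rw [adIter, ih, bracket_smul_right, adIter]

theorem IsVergnePair.relations {d : StructConst K} {x y : Fin 8 → K} {a₁ a₂ a₄ a₅ a₆ a₇ a₈ : K}
    (h : IsVergnePair d x y a₁ a₂ a₄ a₅ a₆ a₇ a₈) :
    VergneRelations d x y a₁ a₂ a₄ a₅ a₆ a₇ a₈ := by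
  obtain ⟨g, rfl, rfl, hg⟩ := h
  set v := vergneLaw a₁ a₂ a₄ a₅ a₆ a₇ a₈ with hv
  have e0 : adIter v (basisVec K 0) (basisVec K 1) 0 = basisVec K 1 := rfl
  have e1 : adIter v (basisVec K 0) (basisVec K 1) 1 = basisVec K 2 := by
    rw [adIter, e0, bracket_basisVec]
    funext k
    simp [hv, vergneLaw, vergneUpper]
  have e2 : adIter v (basisVec K 0) (basisVec K 1) 2 = basisVec K 3 := by
    rw [adIter, e1, bracket_basisVec]
    funext k
    simp [hv, vergneLaw, vergneUpper]
  have e3 : adIter v (basisVec K 0) (basisVec K 1) 3 = basisVec K 4 := by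
    rw [adIter, e2, bracket_basisVec]
    funext k
    simp [hv, vergneLaw, vergneUpper]
  have e4 : adIter v (basisVec K 0) (basisVec K 1) 4 = basisVec K 5 := by
    rw [adIter, e3, bracket_basisVec]
    funext k
    simp [hv, vergneLaw, vergneUpper]
  have e5 : adIter v (basisVec K 0) (basisVec K 1) 5 = basisVec K 6 := by
    rw [adIter, e4, bracket_basisVec]
    funext k
    simp [hv, vergneLaw, vergneUpper]
  have e6 : adIter v (basisVec K 0) (basisVec K 1) 6 = basisVec K 7 := by
    rw [adIter, e5, bracket_basisVec]
    funext k
    simp [hv, vergneLaw, vergneUpper]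
  constructor
  · rw [adIter_map hg, e6]
    simp [basisVec]
  all_goals
    simp only [adIter_map hg, e1, e2, e3, e4, e5, e6, hg, ← map_smul, ← map_add]
    rw [bracket_basisVec]
    first | (rw [EmbeddingLike.map_eq_zero_iff]) | refine congrArg g ?_
    funext k
    simp [hv, vergneLaw, vergneUpper]

/-- The first five parameters of the Vergne form with respect to the basis generated by `x, y`,
multiplied by the cube of a coordinate of the last basis vector. -/
def scaledParams (d : StructConst K) (x y : Fin 8 → K) (m : Fin 8) : Fin 5 → K :=
  let E := adIter d x y
  let b₂₅ := bracket d (E 1) (E 4) m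
  let b₁₅ := bracket d y (E 4) m
  let b₂₄ := bracket d (E 1) (E 3) m
  let b₁₄ := bracket d y (E 3) m
  let b₂₃ := bracket d (E 1) (E 2) m
  ![b₂₅ * E 6 m ^ 2,
    (b₁₅ * E 6 m - b₂₅ * E 5 m) * E 6 m,
    b₂₄ * E 6 m ^ 2,
    b₁₄ * E 6 m ^ 2 - b₂₅ * E 4 m * E 6 m - (b₁₅ * E 6 m - b₂₅ * E 5 m + b₂₄ * E 6 m) * E 5 m,
    (b₂₃ * E 6 m - b₂₄ * E 5 m) * E 6 m]

/-- The relations are triangular in the parameters: at coordinate `m`, each new parameter is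
multiplied by the same entry of `(ad x)⁶ y`. Solving successively and clearing denominators produces
the cube. -/
theorem VergneRelations.scaledParams_eq {d : StructConst K} {x y : Fin 8 → K}
    {a₁ a₂ a₄ a₅ a₆ a₇ a₈ : K} (h : VergneRelations d x y a₁ a₂ a₄ a₅ a₆ a₇ a₈) (m : Fin 8) :
    scaledParams d x y m = adIter d x y 6 m ^ 3 • ![a₁, a₂, a₄, a₅, a₆] := by
  simp only [scaledParams, h.rel₂₅, h.rel₁₅, h.rel₂₄, h.rel₁₄, h.rel₂₃, Pi.add_apply,
    Pi.smul_apply, smul_eq_mul]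
  funext i
  fin_cases i <;> simp <;> ring

theorem scaledParams_smul (d : StructConst K) (x y : Fin 8 → K) (r : K) (m : Fin 8) :
    scaledParams d x (r • y) m = r ^ 4 • scaledParams d x y m := by
  simp only [scaledParams, adIter_smul, bracket_smul_left, bracket_smul_right, Pi.smul_apply,
    smul_eq_mul]
  funext i
  fin_cases i <;> simp <;> ring

/-- A multiple of `y` corrected by a multiple of `x` so as to commute with `(ad x)⁵ y`. -/
def adjusted (d : StructConst K) (x y : Fin 8 → K) (m : Fin 8) : Fin 8 → K :=
  adIter d x y 6 m • y - bracket d y (adIter d x y 5) m • x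

theorem adIter_sub_smul {d : StructConst K} (hd : d ∈ LieVar K) [CharZero K] (x y : Fin 8 → K)
    (r s : K) (j : ℕ) :
    adIter d x (r • y - s • x) (j + 1) = r • adIter d x y (j + 1) := by
  have hself : bracket d x x = 0 := by
    have := (mem_LieVar_iff.mp hd).1 x x
    rwa [self_eq_neg] at this
  induction j with
  | zero => simp [adIter, bracket_sub_right, bracket_smul_right, hself]
  | succ j ih => rw [adIter, ih, bracket_smul_right]; rfl

theorem isPolyFun_adIter {x : Fin 8 → K} {y : StructConst K → Fin 8 → K}
    (hy : ∀ i, IsPolyFun fun d => y d i) (j : ℕ) (k : Fin 8) :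
    IsPolyFun fun d => adIter d x (y d) j k := by
  induction j generalizing k with
  | zero => exact hy k
  | succ j ih =>
    exact IsPolyFun.bracket (f := fun _ => x) (g := fun d => adIter d x (y d) j)
      (fun i => IsPolyFun.const (x i)) ih k

theorem isPolyFun_adjusted (x y : Fin 8 → K) (m k : Fin 8) :
    IsPolyFun fun d => adjusted d x y m k := by
  have hy : ∀ i, IsPolyFun fun _ : StructConst K => y i := fun i => IsPolyFun.const _
  have E : ∀ j k, IsPolyFun fun d => adIter d x y j k := isPolyFun_adIter (y := fun _ => y) hy
  have b : IsPolyFun fun d => bracket d y (adIter d x y 5) m := IsPolyFun.bracket hy (E 5) m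
  exact ((E 6 m).mul (hy k)).sub (b.mul (IsPolyFun.const (x k)))

theorem isPolyFun_scaledParams {x : Fin 8 → K} {y : StructConst K → Fin 8 → K}
    (hy : ∀ i, IsPolyFun fun d => y d i) (m : Fin 8) (i : Fin 5) :
    IsPolyFun fun d => scaledParams d x (y d) m i := by
  have E : ∀ j, IsPolyFun fun d => adIter d x (y d) j m := fun j => isPolyFun_adIter hy j m
  have b : ∀ j k, IsPolyFun fun d => bracket d (adIter d x (y d) j) (adIter d x (y d) k) m :=
    fun j k => IsPolyFun.bracket (isPolyFun_adIter hy j) (isPolyFun_adIter hy k) m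
  have b' : ∀ k, IsPolyFun fun d => bracket d (y d) (adIter d x (y d) k) m :=
    fun k => IsPolyFun.bracket hy (isPolyFun_adIter hy k) m
  unfold scaledParams
  fin_cases i <;> simp only [Fin.zero_eta, Fin.mk_one, Fin.reduceFinMk, Matrix.cons_val]
  · exact (b 1 4).mul ((E 6).pow 2)
  · exact (((b' 4).mul (E 6)).sub ((b 1 4).mul (E 5))).mul (E 6)
  · exact (b 1 3).mul ((E 6).pow 2)
  · exact (((b' 3).mul ((E 6).pow 2)).sub (((b 1 4).mul (E 4)).mul (E 6))).sub
      (((((b' 4).mul (E 6)).sub ((b 1 4).mul (E 5))).add ((b 1 3).mul (E 6))).mul (E 5))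
  · exact (((b 1 2).mul (E 6)).sub ((b 1 3).mul (E 5))).mul (E 6)

theorem IsPolyFun.eval {σ : Type*} {f : σ → StructConst K → K} (hf : ∀ i, IsPolyFun (f i))
    (F : MvPolynomial σ K) : IsPolyFun fun c => MvPolynomial.eval (fun i => f i c) F := by
  choose p hp using hf
  refine ⟨MvPolynomial.bind₁ p F, fun c => ?_⟩
  have := MvPolynomial.eval₂Hom_bind₁ (RingHom.id K) c p F
  simp only [← hp]
  exact this

/-- The defect `[y, (ad x)⁵ y]` lies in the one-dimensional `C₁`, hence is a multiple of `(ad x)⁶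
y`. Subtracting a multiple of `x` from `y` cancels it and does not affect the iterates beyond
scaling. -/
theorem exists_isVergnePair_adjusted [CharZero K] {d : StructConst K} (hd : d ∈ FilVar K)
    {x y : Fin 8 → K} {m : Fin 8} (hm : adIter d x y 6 m ≠ 0) :
    ∃ a₁ a₂ a₄ a₅ a₆ a₇ a₈ : K, a₁ * (5 * a₄ + 2 * a₂) = 0 ∧
      IsVergnePair d x (adjusted d x y m) a₁ a₂ a₄ a₅ a₆ a₇ a₈ := by
  have hE := adIter_sub_smul hd.1.1 x y (adIter d x y 6 m) (bracket d y (adIter d x y 5) m)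
  obtain ⟨t, ht⟩ : ∃ t : K, bracket d y (adIter d x y 5) = t • adIter d x y 6 := by
    have h5 := adIter_mem_ascSeries hd x y (j := 5) (by omega)
    have h6 := adIter_mem_ascSeries hd x y (j := 6) (by omega)
    have hy5 : bracket d y (adIter d x y 5) ∈ ascSeries d 1 := by
      rw [(mem_LieVar_iff.mp hd.1.1).1]
      exact neg_mem (h5 y)
    obtain ⟨t, ht⟩ := exists_sub_smul_mem (ascSeries_le_succ 0)
      (by rw [hd.2 _ (by omega), hd.2 _ (by omega)]) h6
      (fun h0 => hm (congrFun (show adIter d x y 6 = 0 from h0) m)) hy5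
    exact ⟨t, sub_eq_zero.mp ht⟩
  refine exists_isVergnePair hd ?_ ?_
  · rw [adjusted, hE]
    simp only [bracket_smul_right, bracket_sub_left, bracket_smul_left, ht,
      Pi.smul_apply, smul_eq_mul]
    change _ • (_ - _ • adIter d x y 6) = _
    rw [smul_smul, mul_comm t, sub_self, smul_zero]
  · rw [adjusted, hE]
    exact smul_ne_zero hm fun h0 => hm (congrFun h0 m)

theorem exists_mem_lawOrbit_vergneLaw [CharZero K] {d : StructConst K} (hd : d ∈ FilVar K) :
    ∃ a₁ a₂ a₄ a₅ a₆ a₇ a₈ : K, a₁ * (5 * a₄ + 2 * a₂) = 0 ∧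
      d ∈ lawOrbit (vergneLaw a₁ a₂ a₄ a₅ a₆ a₇ a₈) := by
  obtain ⟨x, y, h⟩ := exists_adIter_six_ne_zero hd
  obtain ⟨m, hm⟩ := Function.ne_iff.mp h
  obtain ⟨a₁, a₂, a₄, a₅, a₆, a₇, a₈, ha, hp⟩ := exists_isVergnePair_adjusted hd hm
  exact ⟨a₁, a₂, a₄, a₅, a₆, a₇, a₈, ha, hp.mem_lawOrbit⟩

/-- A homogeneous equation in the parameters of the Vergne forms of a filiform law is a closed
condition on the law. -/
theorem exists_isZariskiClosed_of_params [CharZero K] (F : MvPolynomial (Fin 5) K) {n : ℕ}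
    (hn : n ≠ 0)
    (hF : ∀ (r : K) (a : Fin 5 → K),
      MvPolynomial.eval (r • a) F = r ^ n * MvPolynomial.eval a F) :
    ∃ Z : Set (StructConst K), IsZariskiClosed Z ∧ ∀ d ∈ FilVar K, (d ∈ Z ↔
      ∀ a₁ a₂ a₄ a₅ a₆ a₇ a₈ : K, a₁ * (5 * a₄ + 2 * a₂) = 0 →
        d ∈ lawOrbit (vergneLaw a₁ a₂ a₄ a₅ a₆ a₇ a₈) →
        MvPolynomial.eval ![a₁, a₂, a₄, a₅, a₆] F = 0) := by
  -- The closed set requires `F` to vanish at the scaled parameters of every adjusted pair `x, y`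
  -- and every coordinate `m`; quantifying over all pairs avoids choosing a basis as the law varies.
  refine ⟨_, isZariskiClosed_of_isPolyFun (ι := (Fin 8 → K) × (Fin 8 → K) × Fin 8)
    (f := fun p d => MvPolynomial.eval
      (scaledParams d p.1 (adjusted d p.1 p.2.1 p.2.2) p.2.2) F)
    (fun p => IsPolyFun.eval
      (fun i => isPolyFun_scaledParams (isPolyFun_adjusted p.1 p.2.1 p.2.2) p.2.2 i) F), ?_⟩
  intro d hd
  rw [Set.mem_ofPred_eq]
  constructor
  · rintro h a₁ a₂ a₄ a₅ a₆ a₇ a₈ - ⟨g, hg⟩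
    have hr := IsVergnePair.relations (d := d) ⟨g, rfl, rfl, hg⟩
    obtain ⟨m, hm⟩ := Function.ne_iff.mp hr.ne_zero
    have := h ⟨g (basisVec K 0), g (basisVec K 1), m⟩
    -- In a Vergne basis there is no defect, so the adjustment only rescales `y`, and homogeneity of
    -- `F` pulls the scalars out.
    simp only [adjusted, hr.rel₁₆, Pi.zero_apply, zero_smul, sub_zero, scaledParams_smul,
      hr.scaledParams_eq, hF, mul_eq_zero] at this
    rcases this with h | h | h
    · exact absurd (pow_eq_zero_iff (by omega) |>.mp h) (pow_ne_zero _ hm)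
    · exact absurd (pow_eq_zero_iff (by omega) |>.mp h) (pow_ne_zero _ hm)
    · exact h
  · rintro h ⟨x, y, m⟩
    simp only
    have hE := adIter_sub_smul hd.1.1 x y (adIter d x y 6 m) (bracket d y (adIter d x y 5) m)
    -- At a coordinate where `(ad x)⁶ y` vanishes the scaled parameters are all zero; positive
    -- degree of `F` makes the condition empty.
    by_cases hm : adIter d x y 6 m = 0
    · have h0 : scaledParams d x (adjusted d x y m) m = (0 : K) • (0 : Fin 5 → K) := by
        simp only [hm, zero_smul] at hE
        simp only [scaledParams, adjusted, hm, zero_smul, hE]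
        funext i
        fin_cases i <;> simp
      rw [h0, hF, zero_pow hn, zero_mul]
    · obtain ⟨a₁, a₂, a₄, a₅, a₆, a₇, a₈, ha, hp⟩ := exists_isVergnePair_adjusted hd hm
      rw [hp.relations.scaledParams_eq, hF, h _ _ _ _ _ _ _ ha hp.mem_lawOrbit, mul_zero]

end Parameters

/-! ### Diagonal changes of basis and the shift of `X 0` for `a₁ = 0`. -/

section NormalForms

variable {K : Type*} [Field K]

/-- The basis change is diagonal: `X 0` is scaled by `r`, `X 1` by `s`, and `X k` by `r ^ (k - 1) *
s`. A parameter of weight `w` is thus multiplied by `s / r ^ w`; the common factors `bᵢ` keep the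
statement free of division. -/
theorem vergneLaw_scale {r s : K} (hr : r ≠ 0) (hs : s ≠ 0) (b₁ b₂ b₄ b₅ b₆ b₇ b₈ : K) :
    vergneLaw (r * b₁) (r ^ 2 * b₂) (r ^ 2 * b₄) (r ^ 3 * b₅) (r ^ 3 * b₆) (r ^ 4 * b₇)
      (r ^ 5 * b₈) ∈ lawOrbit (vergneLaw (s * b₁) (s * b₂) (s * b₄) (s * b₅) (s * b₆) (s * b₇)
        (s * b₈)) := by
  let c : Fin 8 → K := ![r, s, r * s, r ^ 2 * s, r ^ 3 * s, r ^ 4 * s, r ^ 5 * s, r ^ 6 * s]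
  have hc : ∀ i, c i ≠ 0 := by
    intro i
    fin_cases i <;> simp [c, hr, hs]
  let g : (Fin 8 → K) ≃ₗ[K] (Fin 8 → K) :=
    LinearEquiv.piCongrRight fun i => LinearEquiv.smulOfNeZero K K (c i) (hc i)
  have hg : ∀ x i, g x i = c i * x i := fun x i => rfl
  refine ⟨g, fun x y => ?_⟩
  funext k
  rw [hg, bracket_vergneLaw, bracket_vergneLaw]
  simp only [hg]
  fin_cases k <;> simp [c] <;> ring

variable [CharZero K]

theorem exists_mem_lawOrbit_of_pair {a₁ a₂ a₄ a₅ a₆ a₇ a₈ : K} (h : a₁ * (5 * a₄ + 2 * a₂) = 0)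
    {x y : Fin 8 → K}
    (h5 : bracket (vergneLaw a₁ a₂ a₄ a₅ a₆ a₇ a₈) y
      (adIter (vergneLaw a₁ a₂ a₄ a₅ a₆ a₇ a₈) x y 5) = 0)
    (h6 : adIter (vergneLaw a₁ a₂ a₄ a₅ a₆ a₇ a₈) x y 6 ≠ 0) :
    ∃ b₁ b₂ b₄ b₅ b₆ b₇ b₈ : K, b₁ * (5 * b₄ + 2 * b₂) = 0 ∧
      vergneLaw a₁ a₂ a₄ a₅ a₆ a₇ a₈ ∈ lawOrbit (vergneLaw b₁ b₂ b₄ b₅ b₆ b₇ b₈) ∧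
      VergneRelations (vergneLaw a₁ a₂ a₄ a₅ a₆ a₇ a₈) x y b₁ b₂ b₄ b₅ b₆ b₇ b₈ := by
  obtain ⟨b₁, b₂, b₄, b₅, b₆, b₇, b₈, hb, hp⟩ := exists_isVergnePair (vergneLaw_mem_FilVar h) h5 h6
  exact ⟨b₁, b₂, b₄, b₅, b₆, b₇, b₈, hb, hp.mem_lawOrbit, hp.relations⟩

/-- The new pair is `X 0 + b X 1, X 1`. It moves `a₅, a₆` along a fixed direction and can kill `a₆`,
while preserving `3a₄(a₂ + a₄)a₅ - (2a₂² + 5a₂a₄ + 5a₄²)a₆`. The values `a₇', a₈'` are left open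
because later shifts remove them. -/
theorem vergneLaw_zero_shift (a₂ a₄ a₅ a₆ a₇ a₈ b : K) :
    ∃ a₇' a₈' : K, vergneLaw 0 a₂ a₄ a₅ a₆ a₇ a₈ ∈ lawOrbit (vergneLaw 0 a₂ a₄
      (a₅ - (2 * a₂ ^ 2 + 5 * a₂ * a₄ + 5 * a₄ ^ 2) * b) (a₆ - 3 * a₄ * (a₂ + a₄) * b)
      a₇' a₈') := by
  set v := vergneLaw 0 a₂ a₄ a₅ a₆ a₇ a₈ with hv
  let x : Fin 8 → K := ![1, b, 0, 0, 0, 0, 0, 0]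
  let y : Fin 8 → K := ![0, 1, 0, 0, 0, 0, 0, 0]
  have e1 : adIter v x y 1 = ![0, 0, 1, 0, 0, 0, 0, 0] := by
    rw [adIter, adIter, hv, bracket_vergneLaw]
    simp [x, y]
  have e2 : adIter v x y 2
      = ![0, 0, 0, 1, a₂ * b + 2 * a₄ * b, a₅ * b + a₆ * b, a₇ * b, a₈ * b] := by
    rw [adIter, e1, hv, bracket_vergneLaw]
    funext k
    fin_cases k <;> simp [x] <;> ring
  have e3 : adIter v x y 3 = ![0, 0, 0, 0, 1, 2 * a₂ * b + 4 * a₄ * b,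
      a₂ ^ 2 * b ^ 2 + 2 * a₄ ^ 2 * b ^ 2 + 2 * a₅ * b + 2 * a₆ * b + 3 * a₂ * a₄ * b ^ 2,
      2 * a₇ * b + 2 * a₂ * a₅ * b ^ 2 + a₂ * a₆ * b ^ 2 + 2 * a₄ * a₅ * b ^ 2] := by
    rw [adIter, e2, hv, bracket_vergneLaw]
    funext k
    fin_cases k <;> simp [x] <;> ring
  have e4 : adIter v x y 4 = ![0, 0, 0, 0, 0, 1, 3 * a₂ * b + 5 * a₄ * b,
      3 * a₂ ^ 2 * b ^ 2 + 2 * a₄ ^ 2 * b ^ 2 + 3 * a₅ * b + 2 * a₆ * b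
        + 7 * a₂ * a₄ * b ^ 2] := by
    rw [adIter, e3, hv, bracket_vergneLaw]
    funext k
    fin_cases k <;> simp [x] <;> ring
  have e5 : adIter v x y 5 = ![0, 0, 0, 0, 0, 0, 1, 4 * a₂ * b + 5 * a₄ * b] := by
    rw [adIter, e4, hv, bracket_vergneLaw]
    funext k
    fin_cases k <;> simp [x] <;> ring
  have e6 : adIter v x y 6 = ![0, 0, 0, 0, 0, 0, 0, 1] := by
    rw [adIter, e5, hv, bracket_vergneLaw]
    funext k
    fin_cases k <;> simp [x]
  obtain ⟨b₁, b₂, b₄, b₅, b₆, b₇, b₈, -, hmem, hrel⟩ := exists_mem_lawOrbit_of_pair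
    (a₁ := 0) (a₂ := a₂) (a₄ := a₄) (a₅ := a₅) (a₆ := a₆) (a₇ := a₇) (a₈ := a₈) (by ring)
    (x := x) (y := y) (by
      rw [← hv, e5, hv, bracket_vergneLaw]
      funext k
      fin_cases k <;> simp [y]) (by
      rw [← hv, e6]
      intro h
      simpa using congrFun h 7)
  rw [← hv] at hrel hmem
  have hpar := hrel.scaledParams_eq 7
  simp only [scaledParams, e1, e2, e3, e4, e5, e6] at hpar
  rw [hv] at hpar
  simp only [bracket_vergneLaw] at hpar
  have p1 : b₁ = 0 := by simpa [x, y] using (congrFun hpar 0).symm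
  have p2 : b₂ = a₂ := by
    have := congrFun hpar 1
    simp [y] at this
    linear_combination -this
  have p4 : b₄ = a₄ := by
    have := congrFun hpar 2
    simp [y] at this
    linear_combination -this
  have p5 : b₅ = a₅ - (2 * a₂ ^ 2 + 5 * a₂ * a₄ + 5 * a₄ ^ 2) * b := by
    have := congrFun hpar 3
    simp [y] at this
    linear_combination -this
  have p6 : b₆ = a₆ - 3 * a₄ * (a₂ + a₄) * b := by
    have := congrFun hpar 4
    simp [y] at this
    linear_combination -this
  refine ⟨b₇, b₈, ?_⟩
  rw [← p5, ← p6]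
  rw [p1, p2, p4] at hmem
  exact hmem

end NormalForms

/-! ### Shifts of `X 1`, and the shift of `X 0` for `a₁ = 1`. -/

section Shifts

variable {K : Type*} [Field K] [CharZero K]

/-- Replacing `X 1` by `X 1 + c X 3` can kill `a₇` when `a₄ ≠ 0`, without changing `a₅ + a₆`. -/
theorem vergneLaw_shift_three {a₁ a₂ a₄ a₅ a₆ a₇ a₈ : K} (h : a₁ * (5 * a₄ + 2 * a₂) = 0)
    (c : K) : ∃ a₈' : K, vergneLaw a₁ a₂ a₄ a₅ a₆ a₇ a₈ ∈ lawOrbit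
      (vergneLaw a₁ a₂ a₄ (a₅ - 2 * a₁ * c) (a₆ + 2 * a₁ * c) (a₇ - 2 * a₄ * c) a₈') := by
  set v := vergneLaw a₁ a₂ a₄ a₅ a₆ a₇ a₈ with hv
  let x : Fin 8 → K := ![1, 0, 0, 0, 0, 0, 0, 0]
  let y : Fin 8 → K := ![0, 1, 0, c, 0, 0, 0, 0]
  have e1 : adIter v x y 1 = ![0, 0, 1, 0, c, 0, 0, 0] := by
    rw [adIter, adIter, hv, bracket_vergneLaw]
    funext k
    fin_cases k <;> simp [x, y]
  have e2 : adIter v x y 2 = ![0, 0, 0, 1, 0, c, 0, 0] := by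
    rw [adIter, e1, hv, bracket_vergneLaw]
    funext k
    fin_cases k <;> simp [x]
  have e3 : adIter v x y 3 = ![0, 0, 0, 0, 1, 0, c, 0] := by
    rw [adIter, e2, hv, bracket_vergneLaw]
    funext k
    fin_cases k <;> simp [x]
  have e4 : adIter v x y 4 = ![0, 0, 0, 0, 0, 1, 0, c] := by
    rw [adIter, e3, hv, bracket_vergneLaw]
    funext k
    fin_cases k <;> simp [x]
  have e5 : adIter v x y 5 = ![0, 0, 0, 0, 0, 0, 1, 0] := by
    rw [adIter, e4, hv, bracket_vergneLaw]
    funext k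
    fin_cases k <;> simp [x]
  have e6 : adIter v x y 6 = ![0, 0, 0, 0, 0, 0, 0, 1] := by
    rw [adIter, e5, hv, bracket_vergneLaw]
    funext k
    fin_cases k <;> simp [x]
  obtain ⟨b₁, b₂, b₄, b₅, b₆, b₇, b₈, -, hmem, hrel⟩ := exists_mem_lawOrbit_of_pair h
    (x := x) (y := y) (by
      rw [← hv, e5, hv, bracket_vergneLaw]
      funext k
      fin_cases k <;> simp [y]) (by
      rw [← hv, e6]
      intro h
      simpa using congrFun h 7)
  rw [← hv] at hrel hmem
  have hpar := hrel.scaledParams_eq 7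
  have h13 := congrFun hrel.rel₁₃ 7
  simp only [scaledParams, e1, e2, e3, e4, e5, e6] at hpar h13
  rw [hv] at hpar h13
  simp only [bracket_vergneLaw] at hpar h13
  have p1 : b₁ = a₁ := by simpa [x, y] using (congrFun hpar 0).symm
  have p2 : b₂ = a₂ := by
    have := congrFun hpar 1
    simp [y] at this
    linear_combination -this
  have p4 : b₄ = a₄ := by
    have := congrFun hpar 2
    simp [y] at this
    linear_combination -this
  have p5 : b₅ = a₅ - 2 * a₁ * c := by
    have := congrFun hpar 3
    simp [y] at this
    linear_combination -this
  have p6 : b₆ = a₆ + 2 * a₁ * c := by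
    have := congrFun hpar 4
    simp [y] at this
    linear_combination -this
  have p7 : b₇ = a₇ - 2 * a₄ * c := by
    simp [y, p1, p2, p4, p5, p6] at h13
    linear_combination -h13
  refine ⟨b₈, ?_⟩
  rw [p1, p2, p4, p5, p6, p7] at hmem
  exact hmem

/-- Replacing `X 1` by `X 1 + c X 4` can kill `a₈` when `a₄ ≠ 0`. -/
theorem vergneLaw_shift_four {a₁ a₂ a₄ a₅ a₆ a₇ a₈ : K} (h : a₁ * (5 * a₄ + 2 * a₂) = 0)
    (c : K) : vergneLaw a₁ a₂ a₄ a₅ a₆ a₇ a₈ ∈ lawOrbit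
      (vergneLaw a₁ a₂ a₄ a₅ a₆ a₇ (a₈ - 3 * a₄ * c)) := by
  set v := vergneLaw a₁ a₂ a₄ a₅ a₆ a₇ a₈ with hv
  let x : Fin 8 → K := ![1, 0, 0, 0, 0, 0, 0, 0]
  let y : Fin 8 → K := ![0, 1, 0, 0, c, 0, 0, 0]
  have e1 : adIter v x y 1 = ![0, 0, 1, 0, 0, c, 0, 0] := by
    rw [adIter, adIter, hv, bracket_vergneLaw]
    funext k
    fin_cases k <;> simp [x, y]
  have e2 : adIter v x y 2 = ![0, 0, 0, 1, 0, 0, c, 0] := by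
    rw [adIter, e1, hv, bracket_vergneLaw]
    funext k
    fin_cases k <;> simp [x]
  have e3 : adIter v x y 3 = ![0, 0, 0, 0, 1, 0, 0, c] := by
    rw [adIter, e2, hv, bracket_vergneLaw]
    funext k
    fin_cases k <;> simp [x]
  have e4 : adIter v x y 4 = ![0, 0, 0, 0, 0, 1, 0, 0] := by
    rw [adIter, e3, hv, bracket_vergneLaw]
    funext k
    fin_cases k <;> simp [x]
  have e5 : adIter v x y 5 = ![0, 0, 0, 0, 0, 0, 1, 0] := by
    rw [adIter, e4, hv, bracket_vergneLaw]
    funext k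
    fin_cases k <;> simp [x]
  have e6 : adIter v x y 6 = ![0, 0, 0, 0, 0, 0, 0, 1] := by
    rw [adIter, e5, hv, bracket_vergneLaw]
    funext k
    fin_cases k <;> simp [x]
  obtain ⟨b₁, b₂, b₄, b₅, b₆, b₇, b₈, -, hmem, hrel⟩ := exists_mem_lawOrbit_of_pair h
    (x := x) (y := y) (by
      rw [← hv, e5, hv, bracket_vergneLaw]
      funext k
      fin_cases k <;> simp [y]) (by
      rw [← hv, e6]
      intro h
      simpa using congrFun h 7)
  rw [← hv] at hrel hmem
  have hpar := hrel.scaledParams_eq 7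
  have h13 := congrFun hrel.rel₁₃ 7
  have h12 := congrFun hrel.rel₁₂ 7
  simp only [scaledParams, e1, e2, e3, e4, e5, e6] at hpar h13 h12
  rw [hv] at hpar h13 h12
  simp only [bracket_vergneLaw] at hpar h13 h12
  have p1 : b₁ = a₁ := by simpa [x, y] using (congrFun hpar 0).symm
  have p2 : b₂ = a₂ := by
    have := congrFun hpar 1
    simp [y] at this
    linear_combination -this
  have p4 : b₄ = a₄ := by
    have := congrFun hpar 2
    simp [y] at this
    linear_combination -this
  have p5 : b₅ = a₅ := by
    have := congrFun hpar 3
    simp [y] at this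
    linear_combination -this
  have p6 : b₆ = a₆ := by
    have := congrFun hpar 4
    simp [y] at this
    linear_combination -this
  have p7 : b₇ = a₇ := by
    simp [y, p1, p2, p4, p5, p6] at h13
    linear_combination -h13
  have p8 : b₈ = a₈ - 3 * a₄ * c := by
    simp [y, p1, p2, p4, p5, p6, p7] at h12
    linear_combination -h12
  rw [p1, p2, p4, p5, p6, p7, p8] at hmem
  exact hmem

/-- Replacing `X 1` by `X 1 + c X 5` can kill `a₈` when `a₁ ≠ 0`; this is the version used for the
second family. -/
theorem vergneLaw_shift_five {a₁ a₂ a₄ a₅ a₆ a₇ a₈ : K} (h : a₁ * (5 * a₄ + 2 * a₂) = 0)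
    (c : K) : vergneLaw a₁ a₂ a₄ a₅ a₆ a₇ a₈ ∈ lawOrbit
      (vergneLaw a₁ a₂ a₄ a₅ a₆ a₇ (a₈ - 2 * a₁ * c)) := by
  set v := vergneLaw a₁ a₂ a₄ a₅ a₆ a₇ a₈ with hv
  let x : Fin 8 → K := ![1, 0, 0, 0, 0, 0, 0, 0]
  let y : Fin 8 → K := ![0, 1, 0, 0, 0, c, 0, 0]
  have e1 : adIter v x y 1 = ![0, 0, 1, 0, 0, 0, c, 0] := by
    rw [adIter, adIter, hv, bracket_vergneLaw]
    funext k
    fin_cases k <;> simp [x, y]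
  have e2 : adIter v x y 2 = ![0, 0, 0, 1, 0, 0, 0, c] := by
    rw [adIter, e1, hv, bracket_vergneLaw]
    funext k
    fin_cases k <;> simp [x]
  have e3 : adIter v x y 3 = ![0, 0, 0, 0, 1, 0, 0, 0] := by
    rw [adIter, e2, hv, bracket_vergneLaw]
    funext k
    fin_cases k <;> simp [x]
  have e4 : adIter v x y 4 = ![0, 0, 0, 0, 0, 1, 0, 0] := by
    rw [adIter, e3, hv, bracket_vergneLaw]
    funext k
    fin_cases k <;> simp [x]
  have e5 : adIter v x y 5 = ![0, 0, 0, 0, 0, 0, 1, 0] := by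
    rw [adIter, e4, hv, bracket_vergneLaw]
    funext k
    fin_cases k <;> simp [x]
  have e6 : adIter v x y 6 = ![0, 0, 0, 0, 0, 0, 0, 1] := by
    rw [adIter, e5, hv, bracket_vergneLaw]
    funext k
    fin_cases k <;> simp [x]
  obtain ⟨b₁, b₂, b₄, b₅, b₆, b₇, b₈, -, hmem, hrel⟩ := exists_mem_lawOrbit_of_pair h
    (x := x) (y := y) (by
      rw [← hv, e5, hv, bracket_vergneLaw]
      funext k
      fin_cases k <;> simp [y]) (by
      rw [← hv, e6]
      intro h
      simpa using congrFun h 7)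
  rw [← hv] at hrel hmem
  have hpar := hrel.scaledParams_eq 7
  have h13 := congrFun hrel.rel₁₃ 7
  have h12 := congrFun hrel.rel₁₂ 7
  simp only [scaledParams, e1, e2, e3, e4, e5, e6] at hpar h13 h12
  rw [hv] at hpar h13 h12
  simp only [bracket_vergneLaw] at hpar h13 h12
  have p1 : b₁ = a₁ := by simpa [x, y] using (congrFun hpar 0).symm
  have p2 : b₂ = a₂ := by
    have := congrFun hpar 1
    simp [y] at this
    linear_combination -this
  have p4 : b₄ = a₄ := by
    have := congrFun hpar 2
    simp [y] at this
    linear_combination -this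
  have p5 : b₅ = a₅ := by
    have := congrFun hpar 3
    simp [y] at this
    linear_combination -this
  have p6 : b₆ = a₆ := by
    have := congrFun hpar 4
    simp [y] at this
    linear_combination -this
  have p7 : b₇ = a₇ := by
    simp [y, p1, p2, p4, p5, p6] at h13
    linear_combination -h13
  have p8 : b₈ = a₈ - 2 * a₁ * c := by
    simp [y, p1, p2, p4, p5, p6, p7] at h12
    linear_combination -h12
  rw [p1, p2, p4, p5, p6, p7, p8] at hmem
  exact hmem

/-- The new pair is `X 0 + (B - 1) X 1, B X 1`: adding a multiple of `X 1` to `X 0` disturbs `a₁ =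
1`, and the factor `B` restores it. The values `5p, -2p` parametrize the solutions of `5a₄ + 2a₂ =
0`. Only the sum `a₅ + a₆` needs tracking, since the second family has it equal to zero. -/
theorem vergneLaw_one_shift (p a₅ a₆ a₇ a₈ : K) {B : K} (hB : B ≠ 0) :
    ∃ a₅' a₆' a₇' a₈' : K, a₅' + a₆' = (a₅ + a₆ + 2 * p ^ 2 * (1 / B - 1)) / B ^ 3 ∧
      vergneLaw 1 (5 * p) (-2 * p) a₅ a₆ a₇ a₈ ∈ lawOrbit
        (vergneLaw 1 (5 * (p / B ^ 2)) (-2 * (p / B ^ 2)) a₅' a₆' a₇' a₈') := by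
  set v := vergneLaw 1 (5 * p) (-2 * p) a₅ a₆ a₇ a₈ with hv
  let x : Fin 8 → K := ![1, B - 1, 0, 0, 0, 0, 0, 0]
  let y : Fin 8 → K := ![0, B, 0, 0, 0, 0, 0, 0]
  have e1 : adIter v x y 1 = ![0, 0, B, 0, 0, 0, 0, 0] := by
    rw [adIter, adIter, hv, bracket_vergneLaw]
    simp [x, y]
  have e2 : adIter v x y 2 = ![0, 0, 0, B ^ 2, (B ^ 2 - B) * p, (B ^ 2 - B) * (a₅ + a₆),
      (B ^ 2 - B) * a₇, (B ^ 2 - B) * a₈] := by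
    rw [adIter, e1, hv, bracket_vergneLaw]
    funext k
    fin_cases k <;> simp [x] <;> ring
  have e3 : adIter v x y 3 = ![0, 0, 0, 0, B ^ 3, 2 * (B ^ 3 - B ^ 2) * p,
      3 * B * (B - 1) ^ 2 * p ^ 2 + 2 * (B ^ 3 - B ^ 2) * (a₅ + a₆),
      (B ^ 3 - B) * a₇ + (B - 1) ^ 2 * B * p * (6 * a₅ + 5 * a₆)] := by
    rw [adIter, e2, hv, bracket_vergneLaw]
    funext k
    fin_cases k <;> simp [x] <;> ring
  have e4 : adIter v x y 4 = ![0, 0, 0, 0, 0, B ^ 4, 5 * (B ^ 4 - B ^ 3) * p,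
      (3 * B + 4 * B ^ 2 - 17 * B ^ 3 + 10 * B ^ 4) * p ^ 2
        + (-2 * B ^ 2 + B ^ 3 + B ^ 4) * a₅ + 2 * (B ^ 3 - B ^ 2) * a₆] := by
    rw [adIter, e3, hv, bracket_vergneLaw]
    funext k
    fin_cases k <;> simp [x] <;> ring
  have e5 : adIter v x y 5 = ![0, 0, 0, 0, 0, 0, B ^ 5, 5 * (B ^ 5 - B ^ 3) * p] := by
    rw [adIter, e4, hv, bracket_vergneLaw]
    funext k
    fin_cases k <;> simp [x] <;> ring
  have e6 : adIter v x y 6 = ![0, 0, 0, 0, 0, 0, 0, B ^ 5] := by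
    rw [adIter, e5, hv, bracket_vergneLaw]
    funext k
    fin_cases k <;> simp [x]
  obtain ⟨b₁, b₂, b₄, b₅, b₆, b₇, b₈, hb, hmem, hrel⟩ := exists_mem_lawOrbit_of_pair
    (a₁ := 1) (a₂ := 5 * p) (a₄ := -2 * p) (a₅ := a₅) (a₆ := a₆) (a₇ := a₇) (a₈ := a₈) (by ring)
    (x := x) (y := y) (by
      rw [← hv, e5, hv, bracket_vergneLaw]
      funext k
      fin_cases k <;> simp [y]) (by
      rw [← hv, e6]
      intro h
      have := congrFun h 7
      simp [hB] at this)
  rw [← hv] at hrel hmem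
  have hpar := hrel.scaledParams_eq 7
  simp only [scaledParams, e1, e2, e3, e4, e5, e6] at hpar
  rw [hv] at hpar
  simp only [bracket_vergneLaw] at hpar
  have p1 : b₁ = 1 := by
    have := congrFun hpar 0
    simp [y] at this
    apply mul_left_cancel₀ (pow_ne_zero 15 hB)
    linear_combination -this
  have p2 : b₂ = 5 * (p / B ^ 2) := by
    have := congrFun hpar 1
    simp [y] at this
    field_simp
    apply mul_left_cancel₀ (pow_ne_zero 13 hB)
    linear_combination -this
  have p4 : b₄ = -2 * (p / B ^ 2) := by
    rw [p1, p2] at hb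
    linear_combination hb / 5
  have p5 := congrFun hpar 3
  have p6 := congrFun hpar 4
  simp [y] at p5 p6
  refine ⟨b₅, b₆, b₇, b₈, ?_, ?_⟩
  · field_simp
    apply mul_left_cancel₀ (pow_ne_zero 11 hB)
    linear_combination -p5 - p6
  · rw [p1, p2, p4] at hmem
    exact hmem

end Shifts

/-! ### Generic normal forms and non-isomorphism inside the families. -/

section Classification

variable {K : Type*} [Field K] [CharZero K]

/-- The generic laws with `a₁ = 0` are isomorphic to a member of the first family. -/
theorem mem_familyOrbit_familyOne {a₂ a₄ a₅ a₆ a₇ a₈ : K} (h4 : a₄ ≠ 0) (h24 : a₂ + a₄ ≠ 0)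
    (hD : 3 * a₄ * (a₂ + a₄) * a₅ - (2 * a₂ ^ 2 + 5 * a₂ * a₄ + 5 * a₄ ^ 2) * a₆ ≠ 0) :
    vergneLaw 0 a₂ a₄ a₅ a₆ a₇ a₈ ∈ familyOrbit (familyOne K) := by
  -- This shift kills `a₆`; the hypothesis `hD` says exactly that the resulting `a₅` is nonzero.
  obtain ⟨u₇, u₈, h1⟩ := vergneLaw_zero_shift a₂ a₄ a₅ a₆ a₇ a₈ (a₆ / (3 * a₄ * (a₂ + a₄)))
  have e6 : a₆ - 3 * a₄ * (a₂ + a₄) * (a₆ / (3 * a₄ * (a₂ + a₄))) = 0 := by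
    field_simp
    ring
  rw [e6] at h1
  set u₅ := a₅ - (2 * a₂ ^ 2 + 5 * a₂ * a₄ + 5 * a₄ ^ 2) * (a₆ / (3 * a₄ * (a₂ + a₄))) with hu₅
  have hu : u₅ ≠ 0 := by
    intro h
    apply hD
    rw [hu₅] at h
    field_simp at h
    linear_combination h
  obtain ⟨w₈, h2⟩ := vergneLaw_shift_three (a₁ := 0) (a₂ := a₂) (a₄ := a₄) (a₅ := u₅) (a₆ := 0)
    (a₇ := u₇) (a₈ := u₈) (by ring) (u₇ / (2 * a₄))
  have h3 := vergneLaw_shift_four (a₁ := 0) (a₂ := a₂) (a₄ := a₄) (a₅ := u₅) (a₆ := 0)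
    (a₇ := 0) (a₈ := w₈) (by ring) (w₈ / (3 * a₄))
  -- Here `r, s` solve `s a₄ / r² = 1` and `s u₅ / r³ = 1`, normalizing both surviving parameters to
  -- 1 and leaving `a₂ / a₄`.
  have h4' := vergneLaw_scale (r := u₅ / a₄) (s := u₅ ^ 2 / a₄ ^ 3)
    (by positivity) (by positivity) 0 (a₂ * a₄ ^ 2 / u₅ ^ 2) (a₄ ^ 3 / u₅ ^ 2) (a₄ ^ 3 / u₅ ^ 2)
      0 0 0
  have e7 : u₇ - 2 * a₄ * (u₇ / (2 * a₄)) = 0 := by field_simp; ring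
  have e8 : w₈ - 3 * a₄ * (w₈ / (3 * a₄)) = 0 := by field_simp; ring
  simp only [e7, mul_zero, zero_mul, sub_zero, add_zero] at h2
  simp only [e8] at h3
  have f2 : (u₅ / a₄) ^ 2 * (a₂ * a₄ ^ 2 / u₅ ^ 2) = a₂ := by field_simp
  have f4 : (u₅ / a₄) ^ 2 * (a₄ ^ 3 / u₅ ^ 2) = a₄ := by field_simp
  have f5 : (u₅ / a₄) ^ 3 * (a₄ ^ 3 / u₅ ^ 2) = u₅ := by field_simp
  have g2 : u₅ ^ 2 / a₄ ^ 3 * (a₂ * a₄ ^ 2 / u₅ ^ 2) = a₂ / a₄ := by field_simp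
  have g4 : u₅ ^ 2 / a₄ ^ 3 * (a₄ ^ 3 / u₅ ^ 2) = 1 := by field_simp
  simp only [f2, f4, f5, g2, g4, mul_zero] at h4'
  refine ⟨lawOne (a₂ / a₄), ⟨a₂ / a₄, ?_, rfl⟩,
    lawOrbit_trans h4' (lawOrbit_trans h3 (lawOrbit_trans h2 h1))⟩
  intro h
  apply h24
  field_simp at h
  linear_combination h

/-- The generic laws with `5 a₄ + 2 a₂ = 0` are isomorphic to a member of the second family. -/
theorem mem_familyOrbit_familyTwo {a₁ a₂ a₄ a₅ a₆ a₇ a₈ : K} (h1 : a₁ ≠ 0) (h2 : a₂ ≠ 0)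
    (h42 : 5 * a₄ + 2 * a₂ = 0) (hE : 2 * a₂ ^ 2 - 25 * a₁ * (a₅ + a₆) ≠ 0) :
    vergneLaw a₁ a₂ a₄ a₅ a₆ a₇ a₈ ∈ familyOrbit (familyTwo K) := by
  have k1 := vergneLaw_scale (r := (1 : K)) (s := 1 / a₁) one_ne_zero (one_div_ne_zero h1)
    a₁ a₂ a₄ a₅ a₆ a₇ a₈
  simp only [one_pow, one_mul] at k1
  set p := a₂ / (5 * a₁) with hp
  -- The solution of `(a₅ + a₆) / a₁ + 2p²(1/B - 1) = 0`, so that the shift makes `a₅ + a₆` vanish;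
  -- `hE` is what makes `B` meaningful.
  set B := 2 * a₂ ^ 2 / (2 * a₂ ^ 2 - 25 * a₁ * (a₅ + a₆)) with hB
  have hp0 : p ≠ 0 := div_ne_zero h2 (mul_ne_zero (by norm_num) h1)
  have hB0 : B ≠ 0 := by
    rw [hB]
    exact div_ne_zero (mul_ne_zero two_ne_zero (pow_ne_zero 2 h2)) hE
  have e1 : 1 / a₁ * a₁ = 1 := by field_simp
  have e2 : 1 / a₁ * a₂ = 5 * p := by rw [hp]; field_simp
  have e4 : 1 / a₁ * a₄ = -2 * p := by
    rw [hp]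
    field_simp
    linear_combination h42
  rw [e1, e2, e4] at k1
  obtain ⟨u₅, u₆, u₇, u₈, hu, k2⟩ := vergneLaw_one_shift p (1 / a₁ * a₅) (1 / a₁ * a₆)
    (1 / a₁ * a₇) (1 / a₁ * a₈) hB0
  have hu0 : u₅ + u₆ = 0 := by
    rw [hu, hp, hB]
    field_simp
    ring
  obtain rfl : u₆ = -u₅ := by linear_combination hu0
  set q := p / B ^ 2 with hq
  have hq0 : q ≠ 0 := div_ne_zero hp0 (pow_ne_zero 2 hB0)
  have hq5 : 5 * q ≠ 0 := mul_ne_zero (by norm_num) hq0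
  -- Equal factors `r = s` preserve `a₁ = 1`, and the value `5q` turns `a₂ = 5q` into 1.
  have k3 := vergneLaw_scale (r := 5 * q) (s := 5 * q) hq5 hq5
    (1 / (5 * q)) (1 / (5 * q)) (-2 / 5 * (1 / (5 * q))) (u₅ / (5 * q) ^ 3) (-u₅ / (5 * q) ^ 3)
    (u₇ / (5 * q) ^ 4) (u₈ / (5 * q) ^ 5)
  have f1 : 5 * q * (1 / (5 * q)) = 1 := by field_simp
  have f2 : (5 * q) ^ 2 * (1 / (5 * q)) = 5 * q := by field_simp
  have f4 : (5 * q) ^ 2 * (-2 / 5 * (1 / (5 * q))) = -2 * q := by field_simp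
  have f5 : (5 * q) ^ 3 * (u₅ / (5 * q) ^ 3) = u₅ := by field_simp
  have f6 : (5 * q) ^ 3 * (-u₅ / (5 * q) ^ 3) = -u₅ := by field_simp
  have f7 : (5 * q) ^ 4 * (u₇ / (5 * q) ^ 4) = u₇ := by field_simp
  have f8 : (5 * q) ^ 5 * (u₈ / (5 * q) ^ 5) = u₈ := by field_simp
  have g4 : 5 * q * (-2 / 5 * (1 / (5 * q))) = -2 / 5 := by field_simp
  have g6 : 5 * q * (-u₅ / (5 * q) ^ 3) = -(5 * q * (u₅ / (5 * q) ^ 3)) := by ring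
  rw [f1, f2, f4, f5, f6, f7, f8, g4, g6] at k3
  set t := 5 * q * (u₅ / (5 * q) ^ 3)
  set t₇ := 5 * q * (u₇ / (5 * q) ^ 4)
  set t₈ := 5 * q * (u₈ / (5 * q) ^ 5)
  -- The constant `-5/4 * t₇` kills `a₇`, as `a₄ = -2/5`; `a₅ + a₆ = 0` is preserved and only `t`
  -- moves.
  obtain ⟨w₈, k4⟩ := vergneLaw_shift_three (a₁ := 1) (a₂ := 1) (a₄ := -2 / 5) (a₅ := t)
    (a₆ := -t) (a₇ := t₇) (a₈ := t₈) (by ring) (-5 / 4 * t₇)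
  have k5 := vergneLaw_shift_five (a₁ := 1) (a₂ := 1) (a₄ := -2 / 5)
    (a₅ := t - 2 * 1 * (-5 / 4 * t₇)) (a₆ := -t + 2 * 1 * (-5 / 4 * t₇))
    (a₇ := t₇ - 2 * (-2 / 5) * (-5 / 4 * t₇)) (a₈ := w₈) (by ring) (w₈ / 2)
  refine ⟨lawTwo (t - 2 * 1 * (-5 / 4 * t₇)), ⟨_, rfl⟩, ?_⟩
  have g6' : -t + 2 * 1 * (-5 / 4 * t₇) = -(t - 2 * 1 * (-5 / 4 * t₇)) := by ring
  have g7 : t₇ - 2 * (-2 / 5) * (-5 / 4 * t₇) = 0 := by ring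
  have g8 : w₈ - 2 * 1 * (w₈ / 2) = 0 := by ring
  rw [g6', g7] at k4
  rw [g6', g7, g8] at k5
  exact lawOrbit_trans k5 (lawOrbit_trans k4 (lawOrbit_trans k3 (lawOrbit_trans k2 k1)))

theorem adIter_vergneLaw_eq_zero {a₁ a₂ a₄ a₅ a₆ a₇ a₈ : K} (h : a₁ * (5 * a₄ + 2 * a₂) = 0)
    (x y : Fin 8 → K) {j : ℕ} (hj : j < 7) (hj0 : j ≠ 0) {k : Fin 8} (hk : k.val ≤ j) :
    adIter (vergneLaw a₁ a₂ a₄ a₅ a₆ a₇ a₈) x y j k = 0 := by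
  have := adIter_mem_ascSeries (vergneLaw_mem_FilVar (a₅ := a₅) (a₆ := a₆) (a₇ := a₇) (a₈ := a₈) h)
    x y (j := j) (by omega)
  rw [ascSeries_vergneLaw (by omega), mem_tailSpan] at this
  exact this k (by omega)

/-- The condition `a₁ = 0` does not depend on the Vergne basis. -/
theorem first_param_eq_zero {a₂ a₄ a₅ a₆ a₇ a₈ b₁ b₂ b₄ b₅ b₆ b₇ b₈ : K}
    (h : vergneLaw 0 a₂ a₄ a₅ a₆ a₇ a₈ ∈ lawOrbit (vergneLaw b₁ b₂ b₄ b₅ b₆ b₇ b₈)) :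
    b₁ = 0 := by
  obtain ⟨g, hg⟩ := h
  have hr := IsVergnePair.relations ⟨g, rfl, rfl, hg⟩
  set x := g (basisVec K 0)
  set y := g (basisVec K 1)
  have h25 := hr.rel₂₅
  have z : ∀ {j : ℕ} (_ : j < 7) (_ : j ≠ 0) (k : Fin 8) (_ : k.val ≤ j),
    adIter (vergneLaw 0 a₂ a₄ a₅ a₆ a₇ a₈) x y j k = 0 := fun hj hj0 k hk =>
      adIter_vergneLaw_eq_zero (by ring) x y hj hj0 hk
  -- The two vectors start at `X 2` and `X 5`, so their bracket is a multiple of `a₁ X 7`.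
  have h0 : bracket (vergneLaw 0 a₂ a₄ a₅ a₆ a₇ a₈) (adIter (vergneLaw 0 a₂ a₄ a₅ a₆ a₇ a₈) x y 1)
      (adIter (vergneLaw 0 a₂ a₄ a₅ a₆ a₇ a₈) x y 4) = 0 := by
    rw [bracket_vergneLaw]
    have z0 := z (j := 1) (by omega) (by omega) 0 (by simp)
    have z1 := z (j := 1) (by omega) (by omega) 1 (by simp)
    have y0 := z (j := 4) (by omega) (by omega) 0 (by simp)
    have y1 := z (j := 4) (by omega) (by omega) 1 (by simp)
    have y2 := z (j := 4) (by omega) (by omega) 2 (by simp)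
    have y3 := z (j := 4) (by omega) (by omega) 3 (by simp)
    have y4 := z (j := 4) (by omega) (by omega) 4 (by simp)
    simp only [z0, z1, y0, y1, y2, y3, y4]
    funext k
    fin_cases k <;> simp
  rw [h0] at h25
  exact (smul_eq_zero.mp h25.symm).resolve_right hr.ne_zero

/-- Leading coordinates suffice: `(ad x)ʲ y` starts with `x₀ʲ y₁`. Equality of the two values of
`a₄` forces `y₁ = x₀²`, and then the `a₂` relation identifies the parameters. -/
theorem lawOne_injective {α α' : K} (h : lawOne α' ∈ lawOrbit (lawOne α)) : α = α' := by
  obtain ⟨g, hg⟩ := h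
  have hr := IsVergnePair.relations ⟨g, rfl, rfl, hg⟩
  set x := g (basisVec K 0)
  set y := g (basisVec K 1)
  have z : ∀ {j : ℕ} (_ : j < 7) (_ : j ≠ 0) (k : Fin 8) (_ : k.val ≤ j),
    adIter (lawOne α') x y j k = 0 := fun hj hj0 k hk =>
      adIter_vergneLaw_eq_zero (by ring) x y hj hj0 hk
  have hb := fun u w => bracket_vergneLaw (0 : K) α' 1 1 0 0 0 u w
  change ∀ u w, bracket (lawOne α') u w = _ at hb
  have hs : ∀ j, adIter (lawOne α') x y (j + 1)
    = bracket (lawOne α') x (adIter (lawOne α') x y j) := fun j => rfl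
  have E1 := congrFun (hs 0) 2
  have E2 := congrFun (hs 1) 3
  have E3 := congrFun (hs 2) 4
  have E4 := congrFun (hs 3) 5
  have E5 := congrFun (hs 4) 6
  have E6 := congrFun (hs 5) 7
  have r16 := congrFun hr.rel₁₆ 7
  have r24 := congrFun hr.rel₂₄ 7
  have r15 := congrFun hr.rel₁₅ 7
  have hne := hr.ne_zero
  have hne' : adIter (lawOne α') x y 6 7 ≠ 0 := by
    intro h
    apply hne
    funext k
    by_cases hk : k.val ≤ 6
    · exact z (by omega) (by omega) k hk
    · rw [show k = 7 by omega]
      exact h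
  have hy : adIter (lawOne α') x y 0 = y := rfl
  rw [hb] at E1 E2 E3 E4 E5 E6 r16 r24 r15
  have z1 := fun k hk => z (j := 1) (by omega) (by omega) k hk
  have z2 := fun k hk => z (j := 2) (by omega) (by omega) k hk
  have z3 := fun k hk => z (j := 3) (by omega) (by omega) k hk
  have z4 := fun k hk => z (j := 4) (by omega) (by omega) k hk
  have z5 := fun k hk => z (j := 5) (by omega) (by omega) k hk
  simp [hy, z1, z2, z3, z4, z5] at E1 E2 E3 E4 E5 E6 r16 r24 r15
  generalize adIter (lawOne α') x y 1 2 = f₁ at *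
  generalize adIter (lawOne α') x y 2 3 = f₂ at *
  generalize adIter (lawOne α') x y 3 4 = f₃ at *
  generalize adIter (lawOne α') x y 4 5 = f₄ at *
  generalize adIter (lawOne α') x y 5 6 = f₅ at *
  generalize adIter (lawOne α') x y 6 7 = f₆ at *
  have hy0 : y 0 = 0 := r16.resolve_right fun h5 => hne' (by rw [E6, h5, mul_zero])
  rw [hy0, mul_zero, sub_zero] at E1
  rw [hy0, zero_mul, zero_add] at r15
  subst E1 E2 E3 E4 E5 E6
  have hx : x 0 ≠ 0 := left_ne_zero_of_mul hne'
  have hy1 : y 1 ≠ 0 := fun h => hne' (by rw [h]; ring)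
  have hyx : y 1 = x 0 ^ 2 := by
    apply mul_left_cancel₀ (mul_ne_zero (pow_ne_zero 4 hx) hy1)
    linear_combination r24
  rw [hyx] at r15
  apply mul_left_cancel₀ (pow_ne_zero 8 hx)
  linear_combination -r15

/-- The normalizations rigidify the pair: `a₁ = 1` gives `y₁ = x₀ + x₁`, the value of `a₄` gives `x₀
= (x₀ + x₁)²`, and `a₅ + a₆ = 0` gives `x₁ = 0`, whence `x₀ = y₁ = 1`. What remains is to compare
`a₆` and `a₇`. -/
theorem lawTwo_injective {t t' : K} (h : lawTwo t' ∈ lawOrbit (lawTwo t)) : t = t' := by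
  obtain ⟨g, hg⟩ := h
  have hr := IsVergnePair.relations ⟨g, rfl, rfl, hg⟩
  set x := g (basisVec K 0)
  set y := g (basisVec K 1)
  have z : ∀ {j : ℕ} (_ : j < 7) (_ : j ≠ 0) (k : Fin 8) (_ : k.val ≤ j),
    adIter (lawTwo t') x y j k = 0 := fun hj hj0 k hk =>
      adIter_vergneLaw_eq_zero (by ring) x y hj hj0 hk
  have hb := fun u w => bracket_vergneLaw (1 : K) 1 (-2 / 5) t' (-t') 0 0 u w
  change ∀ u w, bracket (lawTwo t') u w = _ at hb
  have hc : ∀ j k, adIter (lawTwo t') x y (j + 1) k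
    = bracket (lawTwo t') x (adIter (lawTwo t') x y j) k := fun j k => rfl
  have E12 := hc 0 2
  have E13 := hc 0 3
  have E14 := hc 0 4
  have E15 := hc 0 5
  have E23 := hc 1 3
  have E24 := hc 1 4
  have E25 := hc 1 5
  have E26 := hc 1 6
  have E34 := hc 2 4
  have E35 := hc 2 5
  have E36 := hc 2 6
  have E37 := hc 2 7
  have E45 := hc 3 5
  have E46 := hc 3 6
  have E47 := hc 3 7
  have E56 := hc 4 6
  have E57 := hc 4 7
  have E67 := hc 5 7
  have r16 := congrFun hr.rel₁₆ 7
  have r25 := congrFun hr.rel₂₅ 7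
  have r24 := congrFun hr.rel₂₄ 7
  have r13 := congrFun hr.rel₁₃ 6
  have r13' := congrFun hr.rel₁₃ 7
  have r23 := congrFun hr.rel₂₃ 7
  have hne := hr.ne_zero
  have hne' : adIter (lawTwo t') x y 6 7 ≠ 0 := by
    intro h
    apply hne
    funext k
    by_cases hk : k.val ≤ 6
    · exact z (by omega) (by omega) k hk
    · rw [show k = 7 by omega]
      exact h
  have hy : adIter (lawTwo t') x y 0 = y := rfl
  rw [hb] at E12 E13 E14 E15 E23 E24 E25 E26 E34 E35 E36 E37 E45 E46 E47 E56 E57 E67 r16 r25 r24 r13 r13' r23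
  have z1 := fun k hk => z (j := 1) (by omega) (by omega) k hk
  have z2 := fun k hk => z (j := 2) (by omega) (by omega) k hk
  have z3 := fun k hk => z (j := 3) (by omega) (by omega) k hk
  have z4 := fun k hk => z (j := 4) (by omega) (by omega) k hk
  have z5 := fun k hk => z (j := 5) (by omega) (by omega) k hk
  simp [hy, z1, z2, z3, z4, z5] at E12 E13 E14 E15 E23 E24 E25 E26 E34 E35 E36 E37 E45 E46 E47 E56 E57 E67 r16 r25 r24 r13 r13' r23
  generalize adIter (lawTwo t') x y 1 2 = f12 at *
  generalize adIter (lawTwo t') x y 1 3 = f13 at *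
  generalize adIter (lawTwo t') x y 1 4 = f14 at *
  generalize adIter (lawTwo t') x y 1 5 = f15 at *
  generalize adIter (lawTwo t') x y 2 3 = f23 at *
  generalize adIter (lawTwo t') x y 2 4 = f24 at *
  generalize adIter (lawTwo t') x y 2 5 = f25 at *
  generalize adIter (lawTwo t') x y 2 6 = f26 at *
  generalize adIter (lawTwo t') x y 3 4 = f34 at *
  generalize adIter (lawTwo t') x y 3 5 = f35 at *
  generalize adIter (lawTwo t') x y 3 6 = f36 at *
  generalize adIter (lawTwo t') x y 3 7 = f37 at *
  generalize adIter (lawTwo t') x y 4 5 = f45 at *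
  generalize adIter (lawTwo t') x y 4 6 = f46 at *
  generalize adIter (lawTwo t') x y 4 7 = f47 at *
  generalize adIter (lawTwo t') x y 5 6 = f56 at *
  generalize adIter (lawTwo t') x y 5 7 = f57 at *
  generalize adIter (lawTwo t') x y 6 7 = f67 at *
  have hy0 : y 0 = 0 := r16.resolve_right fun h5 => hne' (by rw [E67, h5, mul_zero])
  simp only [hy0, mul_zero, zero_mul, sub_zero, zero_add] at E12 E13 E14 E15 r13 r13'
  subst E12 E23 E34 E45 E56 E67
  have hx : x 0 ≠ 0 := left_ne_zero_of_mul hne'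
  have hy1 : y 1 ≠ 0 := fun h => hne' (by rw [h]; ring)
  have hL : x 0 + x 1 ≠ 0 := by
    intro h
    apply hne'
    linear_combination (x 0 ^ 2 * y 1 * (x 0 + x 1) ^ 3) * h
  have hyL : y 1 = x 0 + x 1 := by
    apply mul_left_cancel₀ (mul_ne_zero (mul_ne_zero (pow_ne_zero 2 hx) hy1) (pow_ne_zero 3 hL))
    linear_combination r25
  subst E13 E14 E15 E24 E25 E26 E35 E36 E37 E46 E47 E57
  rw [hyL] at r24 r13 r13' r23
  have hxL : x 0 = (x 0 + x 1) ^ 2 := by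
    apply mul_left_cancel₀ (mul_ne_zero (pow_ne_zero 2 hx) (pow_ne_zero 3 hL))
    linear_combination (-5 / 2) * r24
  have hx1 : x 1 = 0 := by
    apply mul_left_cancel₀ (mul_ne_zero (pow_ne_zero 2 hx) hL)
    linear_combination (-25 / 2) * (r13 - 1 / 5 * ((y 2 - x 2) * (x 0 + x 1) ^ 2
      + x 1 * x 0 * (x 0 + x 1)) * hxL)
  rw [hx1, add_zero] at hxL
  have hx0 : x 0 = 1 := by
    apply mul_left_cancel₀ hx
    linear_combination -hxL
  rw [hx1, hx0] at r23 r13'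
  -- For `a₁ = 1`, `a₄ = -2/5` the quantity `a₆ - (5/2) a₇` is unchanged by the shift of
  -- `vergneLaw_shift_three`, which explains the coefficient.
  linear_combination r23 - 5 / 2 * r13'

end Classification

/-! ### Density, openness and non-rigidity in the two components. -/

section Components

variable {K : Type*} [Field K]

theorem VergneFilOne_subset : VergneFilOne K ⊆ VergneFil K := by
  rintro _ ⟨a₂, a₄, a₅, a₆, a₇, a₈, rfl⟩
  exact ⟨0, a₂, a₄, a₅, a₆, a₇, a₈, by ring, rfl⟩

theorem VergneFilTwo_subset : VergneFilTwo K ⊆ VergneFil K := by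
  rintro _ ⟨a₁, a₂, a₄, a₅, a₆, a₇, a₈, h, rfl⟩
  exact ⟨a₁, a₂, a₄, a₅, a₆, a₇, a₈, by rw [h, mul_zero], rfl⟩

theorem VergneFil_subset : VergneFil K ⊆ FilVar K := by
  rintro _ ⟨a₁, a₂, a₄, a₅, a₆, a₇, a₈, h, rfl⟩
  exact vergneLaw_mem_FilVar h

theorem familyOrbit_subset_FilVar {A : Set (StructConst K)} (hA : A ⊆ VergneFil K) :
    familyOrbit A ⊆ FilVar K := by
  rintro d ⟨c, hc, hd⟩
  exact FilVar_of_mem_lawOrbit hd (VergneFil_subset (hA hc))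

theorem vergneLaw_line (a₁ a₂ a₄ a₅ a₆ a₇ a₈ b₁ b₂ b₄ b₅ b₆ b₇ b₈ s : K) :
    vergneLaw a₁ a₂ a₄ a₅ a₆ a₇ a₈ +
        s • (vergneLaw b₁ b₂ b₄ b₅ b₆ b₇ b₈ - vergneLaw a₁ a₂ a₄ a₅ a₆ a₇ a₈)
      = vergneLaw (a₁ + s * (b₁ - a₁)) (a₂ + s * (b₂ - a₂)) (a₄ + s * (b₄ - a₄))
        (a₅ + s * (b₅ - a₅)) (a₆ + s * (b₆ - a₆)) (a₇ + s * (b₇ - a₇)) (a₈ + s * (b₈ - a₈)) := by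
  refine structConst_ext fun x y => ?_
  have hline : ∀ c d : StructConst K, bracket (c + s • (d - c)) x y
      = bracket c x y + s • (bracket d x y - bracket c x y) := by
    intro c d
    funext k
    simp only [bracket, Pi.add_apply, Pi.smul_apply, Pi.sub_apply, smul_eq_mul, mul_add,
      Finset.sum_add_distrib, Finset.mul_sum, ← Finset.sum_sub_distrib]
    refine congrArg _ (Finset.sum_congr rfl fun i _ => Finset.sum_congr rfl fun j _ => ?_)
    ring
  rw [hline]
  simp only [bracket_vergneLaw]
  funext k
  fin_cases k <;> simp <;> ring

theorem not_isRigidIn_all {c : StructConst K}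
    (h : ¬ IsRigidIn (VergneFil K) c) :
    ¬ IsRigidIn (VergneFil K) c ∧ ¬ IsRigidIn (FilVar K) c ∧
      ¬ IsRigidIn (NilVar K) c ∧ ¬ IsRigidIn (LieVar K) c :=
  ⟨h, fun h' => h (IsZariskiOpenIn.mono h' VergneFil_subset),
    fun h' => h (IsZariskiOpenIn.mono h' fun _ hd => (VergneFil_subset hd).1),
    fun h' => h (IsZariskiOpenIn.mono h' fun _ hd => (VergneFil_subset hd).1.1)⟩

theorem familyOne_subset : familyOne K ⊆ VergneFilOne K := by
  rintro _ ⟨α, -, rfl⟩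
  exact ⟨α, 1, 1, 0, 0, 0, rfl⟩

theorem VergneFilOne_line (c : StructConst K) (hc : c ∈ VergneFilOne K) (d : StructConst K)
    (hd : d ∈ VergneFilOne K) (s : K) : c + s • (d - c) ∈ VergneFilOne K := by
  obtain ⟨a₂, a₄, a₅, a₆, a₇, a₈, rfl⟩ := hc
  obtain ⟨b₂, b₄, b₅, b₆, b₇, b₈, rfl⟩ := hd
  rw [vergneLaw_line, sub_zero, mul_zero, add_zero]
  exact ⟨_, _, _, _, _, _, rfl⟩

theorem VergneFilTwo_line (c : StructConst K) (hc : c ∈ VergneFilTwo K) (d : StructConst K)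
    (hd : d ∈ VergneFilTwo K) (s : K) : c + s • (d - c) ∈ VergneFilTwo K := by
  obtain ⟨a₁, a₂, a₄, a₅, a₆, a₇, a₈, ha, rfl⟩ := hc
  obtain ⟨b₁, b₂, b₄, b₅, b₆, b₇, b₈, hb, rfl⟩ := hd
  rw [vergneLaw_line]
  exact ⟨_, _, _, _, _, _, _, by linear_combination (1 - s) * ha + s * hb, rfl⟩

theorem lawOne_line (t s : K) : lawOne t + s • (lawOne (t + 1) - lawOne t) = lawOne (t + s) := by
  unfold lawOne
  rw [vergneLaw_line]
  congr 1 <;> ring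

theorem lawTwo_line (t s : K) : lawTwo t + s • (lawTwo (t + 1) - lawTwo t) = lawTwo (t + s) := by
  unfold lawTwo
  rw [vergneLaw_line]
  congr 1 <;> ring

theorem isZariskiOpenIn_of_closed_compl {V O Z : Set (StructConst K)} (hZ : IsZariskiClosed Z)
    (h : ∀ d ∈ V, d ∈ Z ↔ d ∉ O) : IsZariskiOpenIn V (O ∩ V) := by
  refine ⟨Z, hZ, ?_⟩
  ext d
  constructor
  · rintro ⟨hO, hV⟩
    exact ⟨hV, fun hdZ => (h d hV).mp hdZ hO⟩
  · rintro ⟨hV, hdZ⟩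
    exact ⟨by_contra fun hO => hdZ ((h d hV).mpr hO), hV⟩

variable [CharZero K]

/-- On a line inside `W`, the points outside `O` are cut out by `Z'` and are finite in number
because `q ∈ O`. If `p ∉ Z`, the points in `Z` are also finite in number; an infinite field leaves a
point of `O` outside `Z`. -/
theorem mem_of_line {p q : StructConst K} {W O Z Z' : Set (StructConst K)}
    (hl : ∀ s : K, p + s • (q - p) ∈ W) (hq : q ∈ O)
    (hZ' : IsZariskiClosed Z') (hO : ∀ d ∈ W, d ∈ Z' ↔ d ∉ O)
    (hZ : IsZariskiClosed Z) (hOZ : O ∩ W ⊆ Z) : p ∈ Z := by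
  by_contra hp
  have h1 := hZ.finite_line (c := p) (d := q) (s₀ := 0) (by simpa using hp)
  have h2 := hZ'.finite_line (c := p) (d := q) (s₀ := 1) (by
    intro h
    rw [one_smul, add_sub_cancel] at h
    have := hl 1
    rw [one_smul, add_sub_cancel] at this
    exact (hO q this).mp h hq)
  obtain ⟨s, hs⟩ := (h1.union h2).exists_notMem
  rw [Set.mem_union, not_or] at hs
  have hsO : p + s • (q - p) ∈ O := by
    by_contra h
    exact hs.2 ((hO _ (hl s)).mpr h)
  exact hs.1 (hOZ ⟨hsO, hl s⟩)

/-- By density of the family orbit in `A`, an open orbit of a point of `A` contains some `T t`. It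
then contains `T (t + s)` for all but finitely many `s`, contradicting injectivity. -/
theorem not_isRigidIn_of_family {A F : Set (StructConst K)} {T : K → StructConst K}
    (hA : A ⊆ VergneFil K)
    (hline : ∀ c ∈ A, ∀ d ∈ A, ∀ s : K, c + s • (d - c) ∈ A) (hT : ∀ t, T t ∈ A)
    (hTline : ∀ t s : K, T t + s • (T (t + 1) - T t) = T (t + s))
    (hinj : ∀ t t', T t' ∈ lawOrbit (T t) → t = t')
    (hFT : ∀ c ∈ F, ∃ t, c = T t) (hne : F.Nonempty) {Z' : Set (StructConst K)}
    (hZ' : IsZariskiClosed Z') (hO : ∀ d ∈ familyOrbit A, d ∈ Z' ↔ d ∉ familyOrbit F)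
    {c : StructConst K} (hc : c ∈ A) : ¬ IsRigidIn (VergneFil K) c := by
  rintro ⟨Z, hZ, h⟩
  obtain ⟨q, hq⟩ := hne
  obtain ⟨t₀, rfl⟩ := hFT q hq
  have hiff : ∀ d ∈ VergneFil K, d ∈ lawOrbit c ↔ d ∉ Z := by
    intro d hd
    constructor
    · intro hdc
      have : d ∈ VergneFil K \ Z := h ▸ ⟨hdc, hd⟩
      exact this.2
    · intro hdZ
      have : d ∈ lawOrbit c ∩ VergneFil K := h ▸ ⟨hd, hdZ⟩
      exact this.1
  have hcZ : c ∉ Z := (hiff c (hA hc)).mp (mem_lawOrbit_self c)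
  obtain ⟨p, hpA, hpF, hpZ⟩ : ∃ p ∈ A, p ∈ familyOrbit F ∧ p ∉ Z := by
    by_contra! hall
    exact hcZ (mem_of_line (W := A) (hline c hc _ (hT t₀)) (subset_familyOrbit F hq) hZ'
      (fun d hd => hO d (subset_familyOrbit A hd)) hZ fun d hd => hall d hd.2 hd.1)
  have hpc := (hiff p (hA hpA)).mpr hpZ
  obtain ⟨_, hτ, hpτ⟩ := hpF
  obtain ⟨t, rfl⟩ := hFT _ hτ
  have htc : T t ∈ lawOrbit c := lawOrbit_trans hpc (lawOrbit_symm hpτ)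
  have htZ := (hiff _ (hA (hT t))).mp htc
  have hfin := hZ.finite_line (c := T t) (d := T (t + 1)) (s₀ := 0) (by simpa using htZ)
  obtain ⟨s, hs⟩ := (hfin.union (Set.finite_singleton 0)).exists_notMem
  rw [Set.mem_union, not_or] at hs
  have hsZ : T (t + s) ∉ Z := by
    rw [← hTline]
    exact hs.1
  have hsc := (hiff _ (hA (hT _))).mpr hsZ
  have := hinj _ _ (lawOrbit_trans (lawOrbit_symm htc) hsc)
  exact hs.2 (by simpa using this)

/-- Density along lines gives one inclusion. The other comes from `Y`, a closed set containing the
family orbit whose filiform members have all their Vergne forms in `A`. -/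
theorem closure_of_family {A F : Set (StructConst K)} (hA : A ⊆ VergneFil K) (hF : F ⊆ A)
    (hline : ∀ c ∈ A, ∀ d ∈ A, ∀ s : K, c + s • (d - c) ∈ A) (hne : F.Nonempty)
    {Z' : Set (StructConst K)}
    (hZ' : IsZariskiClosed Z') (hO : ∀ d ∈ familyOrbit A, d ∈ Z' ↔ d ∉ familyOrbit F)
    {Y : Set (StructConst K)} (hY : IsZariskiClosed Y) (hFY : familyOrbit F ⊆ Y)
    (hYA : ∀ d ∈ FilVar K, d ∈ Y → ∀ a₁ a₂ a₄ a₅ a₆ a₇ a₈ : K, a₁ * (5 * a₄ + 2 * a₂) = 0 →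
      d ∈ lawOrbit (vergneLaw a₁ a₂ a₄ a₅ a₆ a₇ a₈) → vergneLaw a₁ a₂ a₄ a₅ a₆ a₇ a₈ ∈ A) :
    A = zariskiClosureIn (VergneFil K) (familyOrbit F ∩ VergneFil K) ∧
      familyOrbit A = zariskiClosureIn (FilVar K) (familyOrbit F) := by
  obtain ⟨q, hq⟩ := hne
  constructor
  · ext c
    constructor
    · refine fun hc => ⟨hA hc, fun Z hZ hFZ => ?_⟩
      exact mem_of_line (W := A) (hline c hc q (hF hq)) (subset_familyOrbit F hq) hZ'
        (fun d hd => hO d (subset_familyOrbit A hd)) hZ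
        fun d hd => hFZ ⟨hd.1, hA hd.2⟩
    · rintro ⟨hc, h⟩
      have hcY := h Y hY fun d hd => hFY hd.1
      have hcF := VergneFil_subset hc
      obtain ⟨a₁, a₂, a₄, a₅, a₆, a₇, a₈, ha, rfl⟩ := hc
      exact hYA _ hcF hcY _ _ _ _ _ _ _ ha (mem_lawOrbit_self _)
  · ext d
    constructor
    · intro hd
      refine ⟨familyOrbit_subset_FilVar hA hd, fun Z hZ hFZ => ?_⟩
      obtain ⟨c, hc, g, hg⟩ := hd
      -- The family member `q` is transported by the same `g` as `c`, so that the line from `d` to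
      -- `B q` stays in the orbit of `A`.
      obtain ⟨B, hB⟩ := exists_action g
      exact mem_of_line (W := familyOrbit A) (q := B q)
        (fun s => ⟨_, hline c hc q (hF hq) s, line_mem_lawOrbit hg (hB q) s⟩)
        (show B q ∈ familyOrbit F from ⟨q, hq, g, hB q⟩) hZ' hO hZ fun d hd => hFZ hd.1
    · rintro ⟨hd, h⟩
      obtain ⟨a₁, a₂, a₄, a₅, a₆, a₇, a₈, ha, hmem⟩ := exists_mem_lawOrbit_vergneLaw hd
      exact ⟨_, hYA d hd (h Y hY hFY) _ _ _ _ _ _ _ ha hmem, hmem⟩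

theorem lawTwo_mem (t : K) : lawTwo t ∈ VergneFilTwo K :=
  ⟨1, 1, -2 / 5, t, -t, 0, 0, by ring, rfl⟩

theorem familyTwo_subset : familyTwo K ⊆ VergneFilTwo K := by
  rintro _ ⟨t, rfl⟩
  exact lawTwo_mem t

theorem exists_closed_first_component : ∃ Y : Set (StructConst K), IsZariskiClosed Y ∧
    familyOrbit (familyOne K) ⊆ Y ∧
    ∀ d ∈ FilVar K, d ∈ Y → ∀ a₁ a₂ a₄ a₅ a₆ a₇ a₈ : K, a₁ * (5 * a₄ + 2 * a₂) = 0 →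
      d ∈ lawOrbit (vergneLaw a₁ a₂ a₄ a₅ a₆ a₇ a₈) →
      vergneLaw a₁ a₂ a₄ a₅ a₆ a₇ a₈ ∈ VergneFilOne K := by
  obtain ⟨Y, hY, h⟩ := exists_isZariskiClosed_of_params (MvPolynomial.X 0 : MvPolynomial (Fin 5) K)
    one_ne_zero (fun r a => by simp)
  simp only [MvPolynomial.eval_X, Matrix.cons_val_zero] at h
  refine ⟨Y, hY, fun d hd => ?_, fun d hd hdY a₁ a₂ a₄ a₅ a₆ a₇ a₈ ha hmem => ?_⟩
  · refine (h d (familyOrbit_subset_FilVar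
      (familyOne_subset.trans VergneFilOne_subset) hd)).mpr fun a₁ a₂ a₄ a₅ a₆ a₇ a₈ _ hmem => ?_
    obtain ⟨_, ⟨α, -, rfl⟩, hd⟩ := hd
    exact first_param_eq_zero (lawOrbit_trans hmem (lawOrbit_symm hd))
  · rw [(h d hd).mp hdY _ _ _ _ _ _ _ ha hmem]
    exact ⟨_, _, _, _, _, _, rfl⟩

theorem exists_closed_second_component : ∃ Y : Set (StructConst K), IsZariskiClosed Y ∧
    familyOrbit (familyTwo K) ⊆ Y ∧
    ∀ d ∈ FilVar K, d ∈ Y → ∀ a₁ a₂ a₄ a₅ a₆ a₇ a₈ : K, a₁ * (5 * a₄ + 2 * a₂) = 0 →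
      d ∈ lawOrbit (vergneLaw a₁ a₂ a₄ a₅ a₆ a₇ a₈) →
      vergneLaw a₁ a₂ a₄ a₅ a₆ a₇ a₈ ∈ VergneFilTwo K := by
  obtain ⟨Y, hY, h⟩ := exists_isZariskiClosed_of_params
    (5 * MvPolynomial.X 2 + 2 * MvPolynomial.X 1 : MvPolynomial (Fin 5) K)
    one_ne_zero (fun r a => by simp; ring)
  simp only [map_add, map_mul, MvPolynomial.eval_X, map_ofNat, Matrix.cons_val] at h
  refine ⟨Y, hY, fun d hd => ?_, fun d hd hdY a₁ a₂ a₄ a₅ a₆ a₇ a₈ ha hmem => ?_⟩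
  · refine (h d (familyOrbit_subset_FilVar
      (familyTwo_subset.trans VergneFilTwo_subset) hd)).mpr fun a₁ a₂ a₄ a₅ a₆ a₇ a₈ ha hmem => ?_
    obtain ⟨_, ⟨t, rfl⟩, hd⟩ := hd
    -- The second family has `a₁ = 1`; since vanishing of `a₁` is an isomorphism invariant, no
    -- Vergne form of `d` has `a₁ = 0`.
    refine (mul_eq_zero.mp ha).resolve_left ?_
    rintro rfl
    exact one_ne_zero (first_param_eq_zero (lawOrbit_trans hd (lawOrbit_symm hmem)))
  · exact ⟨_, _, _, _, _, _, _, (h d hd).mp hdY _ _ _ _ _ _ _ ha hmem, rfl⟩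

/-- The laws isomorphic to a member of the second family form an open set of filiform laws. -/
theorem exists_closed_compl_familyTwo : ∃ Z : Set (StructConst K), IsZariskiClosed Z ∧
    ∀ d ∈ FilVar K, d ∈ Z ↔ d ∉ familyOrbit (familyTwo K) := by
  obtain ⟨Z, hZ, h⟩ := exists_isZariskiClosed_of_params
    (MvPolynomial.X 0 * MvPolynomial.X 1 * (2 * MvPolynomial.X 1 ^ 2
      - 25 * MvPolynomial.X 0 * (MvPolynomial.X 3 + MvPolynomial.X 4)) : MvPolynomial (Fin 5) K)
    four_ne_zero (fun r a => by simp; ring)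
  simp only [map_add, map_sub, map_mul, map_pow, MvPolynomial.eval_X, map_ofNat,
    Matrix.cons_val] at h
  refine ⟨Z, hZ, fun d hd => ?_⟩
  rw [h d hd]
  constructor
  · rintro hall ⟨_, ⟨t, rfl⟩, hmem⟩
    have := hall 1 1 (-2 / 5) t (-t) 0 0 (by ring) hmem
    norm_num at this
  · intro hnot a₁ a₂ a₄ a₅ a₆ a₇ a₈ ha hmem
    by_contra hne
    obtain ⟨hne, hE⟩ := mul_ne_zero_iff.mp hne
    obtain ⟨h1, h2⟩ := mul_ne_zero_iff.mp hne
    obtain ⟨c, hc, hmem'⟩ := mem_familyOrbit_familyTwo (a₇ := a₇) (a₈ := a₈) h1 h2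
      ((mul_eq_zero.mp ha).resolve_left h1) hE
    exact hnot ⟨c, hc, lawOrbit_trans hmem' hmem⟩

/-- The laws isomorphic to a member of the first family form an open set of the first
component. -/
theorem exists_closed_compl_familyOne : ∃ Z : Set (StructConst K), IsZariskiClosed Z ∧
    ∀ d ∈ familyOrbit (VergneFilOne K), d ∈ Z ↔ d ∉ familyOrbit (familyOne K) := by
  obtain ⟨Z, hZ, h⟩ := exists_isZariskiClosed_of_params
    (MvPolynomial.X 2 * (MvPolynomial.X 1 + MvPolynomial.X 2) *
      (3 * MvPolynomial.X 2 * (MvPolynomial.X 1 + MvPolynomial.X 2) * MvPolynomial.X 3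
        - (2 * MvPolynomial.X 1 ^ 2 + 5 * MvPolynomial.X 1 * MvPolynomial.X 2
          + 5 * MvPolynomial.X 2 ^ 2) * MvPolynomial.X 4) : MvPolynomial (Fin 5) K)
    (n := 5) (by norm_num) (fun r a => by simp; ring)
  simp only [map_add, map_sub, map_mul, map_pow, MvPolynomial.eval_X, map_ofNat,
    Matrix.cons_val] at h
  refine ⟨Z, hZ, fun d hd => ?_⟩
  rw [h d (familyOrbit_subset_FilVar VergneFilOne_subset hd)]
  constructor
  · rintro hall ⟨_, ⟨α, hα, rfl⟩, hmem⟩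
    have := hall 0 α 1 1 0 0 0 (by ring) hmem
    -- On `lawOne α` the polynomial takes the value `3 (α + 1)²`; this is where `α ≠ -1` enters.
    have h1 : (α + 1) ^ 2 = 0 := by linear_combination this / 3
    exact hα (eq_neg_of_add_eq_zero_left (pow_eq_zero_iff two_ne_zero |>.mp h1))
  · intro hnot a₁ a₂ a₄ a₅ a₆ a₇ a₈ ha hmem
    by_contra hne
    obtain ⟨hne, hD⟩ := mul_ne_zero_iff.mp hne
    obtain ⟨h4, h24⟩ := mul_ne_zero_iff.mp hne
    obtain ⟨_, ⟨_, _, _, _, _, _, rfl⟩, hd'⟩ := hd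
    obtain rfl := first_param_eq_zero (lawOrbit_trans hmem (lawOrbit_symm hd'))
    obtain ⟨c, hc, hmem'⟩ := mem_familyOrbit_familyOne (a₇ := a₇) (a₈ := a₈) h4 h24 hD
    exact hnot ⟨c, hc, lawOrbit_trans hmem' hmem⟩

end Components

theorem proposition15 (K : Type*) [Field K] [IsAlgClosed K] [CharZero K] :
    -- second component: no algebra is rigid
    (∀ c ∈ VergneFilTwo K, ¬ IsRigidIn (VergneFil K) c ∧ ¬ IsRigidIn (FilVar K) c ∧
      ¬ IsRigidIn (NilVar K) c ∧ ¬ IsRigidIn (LieVar K) c) ∧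
    -- the second family is a rigid family with one essential parameter
    (∀ t t' : K, lawTwo t' ∈ lawOrbit (lawTwo t) → t = t') ∧
    IsRigidFamilyIn (VergneFil K) (familyTwo K) ∧
    IsRigidFamilyIn (FilVar K) (familyTwo K) ∧
    -- the second component is the closure of this family, among the brackets in Vergne form
    -- and among all filiform brackets
    VergneFilTwo K = zariskiClosureIn (VergneFil K) (familyOrbit (familyTwo K) ∩ VergneFil K) ∧
    familyOrbit (VergneFilTwo K) = zariskiClosureIn (FilVar K) (familyOrbit (familyTwo K)) ∧
    -- first component: no algebra is rigid
    (∀ c ∈ VergneFilOne K, ¬ IsRigidIn (VergneFil K) c ∧ ¬ IsRigidIn (FilVar K) c ∧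
      ¬ IsRigidIn (NilVar K) c ∧ ¬ IsRigidIn (LieVar K) c) ∧
    -- the first family is rigid in the first component, with one essential parameter
    (∀ α α' : K, α ≠ -1 → α' ≠ -1 → lawOne α' ∈ lawOrbit (lawOne α) → α = α') ∧
    IsRigidFamilyIn (VergneFilOne K) (familyOne K) ∧
    IsRigidFamilyIn (familyOrbit (VergneFilOne K)) (familyOne K) ∧
    -- the first component is the closure of the orbit of this family
    VergneFilOne K = zariskiClosureIn (VergneFil K) (familyOrbit (familyOne K) ∩ VergneFil K) ∧
    familyOrbit (VergneFilOne K) = zariskiClosureIn (FilVar K) (familyOrbit (familyOne K)) := by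
  obtain ⟨Z₁, hZ₁, hO₁⟩ := exists_closed_compl_familyOne (K := K)
  obtain ⟨Z₂, hZ₂, hO₂⟩ := exists_closed_compl_familyTwo (K := K)
  obtain ⟨Y₁, hY₁, hF₁, hA₁⟩ := exists_closed_first_component (K := K)
  obtain ⟨Y₂, hY₂, hF₂, hA₂⟩ := exists_closed_second_component (K := K)
  have hO₂' : ∀ d ∈ familyOrbit (VergneFilTwo K), d ∈ Z₂ ↔ d ∉ familyOrbit (familyTwo K) :=
    fun d hd => hO₂ d (familyOrbit_subset_FilVar VergneFilTwo_subset hd)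
  have hne₁ : (familyOne K).Nonempty := ⟨lawOne 0, 0, by norm_num, rfl⟩
  have hne₂ : (familyTwo K).Nonempty := ⟨lawTwo 0, 0, rfl⟩
  have hopen₁ := isZariskiOpenIn_of_closed_compl hZ₁ hO₁
  have hopen₂ := isZariskiOpenIn_of_closed_compl hZ₂ hO₂
  obtain ⟨hc₁, hc₁'⟩ := closure_of_family VergneFilOne_subset familyOne_subset VergneFilOne_line
    hne₁ hZ₁ hO₁ hY₁ hF₁ hA₁
  obtain ⟨hc₂, hc₂'⟩ := closure_of_family VergneFilTwo_subset familyTwo_subset VergneFilTwo_line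
    hne₂ hZ₂ hO₂' hY₂ hF₂ hA₂
  refine ⟨fun c hc => not_isRigidIn_all ?_,
    fun t t' => lawTwo_injective,
    ⟨familyTwo_subset.trans VergneFilTwo_subset, hopen₂.mono VergneFil_subset⟩,
    ⟨(familyTwo_subset.trans VergneFilTwo_subset).trans VergneFil_subset, hopen₂⟩,
    hc₂, hc₂',
    fun c hc => not_isRigidIn_all ?_,
    fun α α' _ _ => lawOne_injective,
    ⟨familyOne_subset, hopen₁.mono (subset_familyOrbit _)⟩,
    ⟨familyOne_subset.trans (subset_familyOrbit _), hopen₁⟩,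
    hc₁, hc₁'⟩
  · exact not_isRigidIn_of_family VergneFilTwo_subset VergneFilTwo_line lawTwo_mem lawTwo_line
      (fun t t' => lawTwo_injective) (fun _ hc => hc) hne₂ hZ₂ hO₂' hc
  · exact not_isRigidIn_of_family VergneFilOne_subset VergneFilOne_line
      (fun α => ⟨α, 1, 1, 0, 0, 0, rfl⟩) lawOne_line
      (fun t t' => lawOne_injective) (fun c hc => hc.imp fun _ h => h.2) hne₁ hZ₁ hO₁ hc
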